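/- Fix $d,n\ge 1$. On a qudit with basis $|0\rangle,\dots,|d-1\rangle$ let $X=\sum_j|j\oplus 1\rangle\langle j|$ (addition mod $d$) and $Z=\sum_j\omega^j|j\rangle\langle j|$ with $\omega=e^{2\pi i/d}$. Let $G'_n$ be the set of operators $g=\bigotimes_{p=1}^n\sigma_p$ on $n$ qudits in which each $\sigma_p$ is $X^a$ or $Z^a$ for some $0\le a\le d-1$; for $T\subseteq\{1,\dots,n\}$ put $g^{(T)}=\bigotimes_{p\in T}\sigma_p$. Partitions are partitions into proper nonempty subsets. For a family $g_1,\dots,g_k$ of such operators on a set of qudits, the stabilizer $S=\langle g_1,\dots,g_k\rangle$ is *separable with respect to a partition* if for every block $T$ the operators $g_1^{(T)},\dots,g_k^{(T)}$ commute; it is *inseparable* if it is separable with respect to no partition; and it is *complete* if the subspace $V_S=\{\psi: g_a\psi=\psi\ \forall a\}$ has dimension $1$. A state of several parties is *distillable between parties $i\neq j$* if there is an entangled pure state $\varphi$ of two systems, held by $i$ and $j$, such that for every $\varepsilon>0$ some LOCC protocol (with finitely many rounds) among all the parties, applied to some finite number of copies of the state, outputs a state whose reduced state on $i,j$ has fidelity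 at least $1-\varepsilon$ with $\varphi$. A state is *bound entangled* if it is not fully separable (not a convex combination of product states of the individual parties) and is not distillable between any two parties. It is *unlockable* if the parties can be divided into groups so that, when the parties of each group join together, it is distillable between some two different groups. A pure state is *genuinely multipartite entangled* if it is not a product across any division of its parties into two nonempty sets. **Theorem.** Let $g_1,\dots,g_k\in G'_n$ commute, let $S=\langle g_1,\dots,g_k\rangle$, and suppose $V_S\ne 0$. Assume: (1) for all $i\ne j$ in $\{1,\dots,n\}$ there is a partition with $i$ and $j$ in different blocks with respect to which $S$ is separable; (2) there is a partition $\{T_1,\dots,T_m\}$ with $|T_1|>1$ with respect to which $S$ is separable and such that $S^{(T_1)}=\langle g_1^{(T_1)},\dots,g_k^{(T_1)}\rangle$ is an inseparable and complete stabilizer on $T_1$. Let $P_S$ be the orthogonal projection onto $V_S$ and $\rho_S=P_S/\operatorname{tr}P_S$. Then $\rho_S$, as a state of $n$ parties holding one qudit each, is a bound entangled state, and it is unlockable. Moreover, for every partition $\{T_1,\dots,T_m\}$ as in (2), if the parties inside each of $T_2,\dots,T_m$ join together, then each of these blocks can be measured in a suitable orthonormal basis such that for every combination of outcomes of nonzero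 probability the resulting state of $T_1$ is a pure, genuinely multipartite entangled state of the parties in $T_1$. -/

import Mathlib

noncomputable section

namespace StabilizerBoundEntanglement

open scoped ComplexOrder

/-! ### Finite-dimensional multipartite systems

`P` is the set of parties; party `p` holds a system with orthonormal basis `H p`, so operators on
the joint system are matrices indexed by `∀ p, H p`. -/

/-- The tensor product of one operator for each party. -/
def tensor {P : Type} [Fintype P] {H K : P → Type} (A : ∀ p, Matrix (H p) (K p) ℂ) :
    Matrix (∀ p, H p) (∀ p, K p) ℂ :=
  Matrix.of fun x y => ∏ p, A p (x p) (y p)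

/-- Density operators. -/
def IsDensity {I : Type} [Fintype I] (ρ : Matrix I I ℂ) : Prop :=
  ρ.PosSemidef ∧ ρ.trace = 1

/-- (Full) separability: a convex combination of products of density operators of the parties. -/
def IsSeparableState {P : Type} [Fintype P] {H : P → Type} [∀ p, Fintype (H p)]
    (ρ : Matrix (∀ p, H p) (∀ p, H p) ℂ) : Prop :=
  ∃ (r : ℕ) (w : Fin r → ℝ) (σ : Fin r → ∀ p, Matrix (H p) (H p) ℂ),
    (∀ s, 0 < w s) ∧ ∑ s, w s = 1 ∧ (∀ s p, IsDensity (σ s p)) ∧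
      ρ = ∑ s, (w s : ℂ) • tensor (σ s)

/-- `N` copies of a state; party `p` holds all its `N` subsystems. -/
def copies {P : Type} {H : P → Type} (N : ℕ) (ρ : Matrix (∀ p, H p) (∀ p, H p) ℂ) :
    Matrix (∀ p, Fin N → H p) (∀ p, Fin N → H p) ℂ :=
  Matrix.of fun x y => ∏ c : Fin N, ρ (fun p => x p c) (fun p => y p c)

/-- LOCC channels with finitely many rounds, from the systems `A` to the systems `B`.
In a round every party `p` performs a local quantum measurement with Kraus operators `K p`
(a party that does nothing uses the single Kraus operator `1`) and announces its outcome;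
the continuation `Λ o` may depend on the list `o` of all outcomes. -/
inductive IsLOCC {P : Type} [Fintype P] [DecidableEq P] {B : P → Type} [∀ p, Fintype (B p)]
    [∀ p, DecidableEq (B p)] :
    ∀ (A : P → Type) [∀ p, Fintype (A p)] [∀ p, DecidableEq (A p)],
      (Matrix (∀ p, A p) (∀ p, A p) ℂ → Matrix (∀ p, B p) (∀ p, B p) ℂ) → Prop
  | done : IsLOCC B (fun ρ => ρ)
  | round (A E : P → Type) [∀ p, Fintype (A p)] [∀ p, DecidableEq (A p)]
      [∀ p, Fintype (E p)] [∀ p, DecidableEq (E p)] (r : P → ℕ)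
      (K : ∀ p, Fin (r p) → Matrix (E p) (A p) ℂ)
      (hK : ∀ p, ∑ o, (K p o).conjTranspose * K p o = 1)
      (Λ : (∀ p, Fin (r p)) → Matrix (∀ p, E p) (∀ p, E p) ℂ → Matrix (∀ p, B p) (∀ p, B p) ℂ)
      (hΛ : ∀ o, IsLOCC E (Λ o)) :
      IsLOCC A (fun ρ => ∑ o : ∀ p, Fin (r p),
        Λ o (tensor (fun p => K p (o p)) * ρ * (tensor (fun p => K p (o p))).conjTranspose))

/-- The fidelity `⟨φ| σᵢⱼ |φ⟩`, where `σᵢⱼ` is the reduced state of `σ` on the parties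
`i ≠ j`. -/
def pairFidelity {P : Type} [Fintype P] [DecidableEq P] {H : P → Type} [∀ p, Fintype (H p)]
    [∀ p, DecidableEq (H p)] (i j : P) (φ : H i → H j → ℂ)
    (σ : Matrix (∀ p, H p) (∀ p, H p) ℂ) : ℝ :=
  (∑ x : ∀ p, H p, ∑ y : ∀ p, H p,
    if ∀ p, p ≠ i → p ≠ j → x p = y p then
      star (φ (x i) (x j)) * σ x y * φ (y i) (y j) else 0).re

/-- Pure entanglement can be distilled from `ρ` between the parties `i ≠ j`: some entangled pure
state `φ` of two systems at `i` and `j` can be prepared with fidelity arbitrarily close to `1`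
by LOCC among all the parties from sufficiently many copies of `ρ`. -/
def IsDistillable {P : Type} [Fintype P] [DecidableEq P] {H : P → Type} [∀ p, Fintype (H p)]
    [∀ p, DecidableEq (H p)] (ρ : Matrix (∀ p, H p) (∀ p, H p) ℂ) (i j : P) : Prop :=
  ∃ (B : P → ℕ) (φ : Fin (B i) → Fin (B j) → ℂ),
    ∑ a, ∑ b, ‖φ a b‖ ^ 2 = 1 ∧
    (¬ ∃ (u : Fin (B i) → ℂ) (v : Fin (B j) → ℂ), ∀ a b, φ a b = u a * v b) ∧
    ∀ ε : ℝ, 0 < ε → ∃ (N : ℕ)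
      (Λ : Matrix (∀ p, Fin N → H p) (∀ p, Fin N → H p) ℂ →
        Matrix (∀ p, Fin (B p)) (∀ p, Fin (B p)) ℂ),
      IsLOCC (fun p => Fin N → H p) Λ ∧
        1 - ε ≤ pairFidelity (H := fun p => Fin (B p)) i j φ (Λ (copies N ρ))

/-- A multipartite state is bound entangled if it is entangled, but no pure entanglement can be
distilled between any two parties while all the parties remain separated. -/
def IsBoundEntangled {P : Type} [Fintype P] [DecidableEq P] {H : P → Type} [∀ p, Fintype (H p)]
    [∀ p, DecidableEq (H p)] (ρ : Matrix (∀ p, H p) (∀ p, H p) ℂ) : Prop :=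
  IsDensity ρ ∧ ¬ IsSeparableState ρ ∧ ∀ i j : P, i ≠ j → ¬ IsDistillable ρ i j

/-- The same state, regarded as a state of the parties obtained by joining the original parties
inside each block of the partition `R`. -/
def group {P : Type} [Fintype P] [DecidableEq P] {H : P → Type}
    (R : Finpartition (Finset.univ : Finset P)) (ρ : Matrix (∀ p, H p) (∀ p, H p) ℂ) :
    Matrix (∀ (U : R.parts) (p : U.1), H p) (∀ (U : R.parts) (p : U.1), H p) ℂ :=
  Matrix.of fun x y =>
    ρ (fun p => x ⟨R.part p, R.part_mem.2 (Finset.mem_univ p)⟩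
          ⟨p, R.mem_part (Finset.mem_univ p)⟩)
      (fun p => y ⟨R.part p, R.part_mem.2 (Finset.mem_univ p)⟩
          ⟨p, R.mem_part (Finset.mem_univ p)⟩)

/-- A multipartite state can be unlocked if the parties can be divided into groups such that,
when the parties inside each group join together, pure entanglement can be distilled between
some two different groups. -/
def IsUnlockable {P : Type} [Fintype P] [DecidableEq P] {H : P → Type} [∀ p, Fintype (H p)]
    [∀ p, DecidableEq (H p)] (ρ : Matrix (∀ p, H p) (∀ p, H p) ℂ) : Prop :=
  ∃ (R : Finpartition (Finset.univ : Finset P)) (U V : R.parts),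
    U ≠ V ∧ IsDistillable (group R ρ) U V

/-- A pure state is genuinely multipartite entangled if it is not a product across any division of
the parties into two nonempty sets. -/
def IsGenuinelyEntangled {P : Type} [Fintype P] [DecidableEq P] {H : P → Type}
    (ψ : (∀ p, H p) → ℂ) : Prop :=
  ∀ A : Finset P, A.Nonempty → A ≠ Finset.univ →
    ¬ ∃ (u : (∀ p : {p // p ∈ A}, H p) → ℂ) (v : (∀ p : {p // p ∉ A}, H p) → ℂ),
      ∀ x : ∀ p, H p, ψ x = u (fun p => x p) * v (fun p => x p)

/-! ### Generalized Pauli operators and stabilizers -/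

section Pauli

variable {d : ℕ} [NeZero d]

/-- `X = ∑ⱼ |j ⊕ 1⟩⟨j|`. -/
def pauliX (d : ℕ) [NeZero d] : Matrix (Fin d) (Fin d) ℂ :=
  Matrix.of fun a b => if a = b + 1 then 1 else 0

/-- `Z = ∑ⱼ ωʲ |j⟩⟨j|` with `ω = exp (2πi/d)`. -/
def pauliZ (d : ℕ) [NeZero d] : Matrix (Fin d) (Fin d) ℂ :=
  Matrix.diagonal fun j => Complex.exp (2 * Real.pi * Complex.I / d) ^ (j : ℕ)

/-- The exponents `(i, j)` of a factor `XⁱZʲ` that is a pure power of `X` or of `Z`. -/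
abbrev PureExponent (d : ℕ) [NeZero d] : Type := {e : Fin d × Fin d // e.1 = 0 ∨ e.2 = 0}

/-- The operator `XⁱZʲ` on one qudit. -/
def sigma (e : PureExponent d) : Matrix (Fin d) (Fin d) ℂ :=
  pauliX d ^ (e.1.1 : ℕ) * pauliZ d ^ (e.1.2 : ℕ)

/-- The tensor product of the `XⁱZʲ` over the qudits in `P`. The operators on `P` of this form are
the elements of `G'`; the exponents are determined by the operator. -/
def pauliOp {P : Type} [Fintype P] (g : P → PureExponent d) : Matrix (P → Fin d) (P → Fin d) ℂ :=
  tensor fun p => sigma (g p)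

/-- The restriction of an element of `G'` to a subset of the qudits. -/
def restrict {P : Type} (g : P → PureExponent d) (T : Finset P) :
    {p // p ∈ T} → PureExponent d :=
  fun p => g p

/-- The operators `g a` commute locally with respect to the partition `Q`: their restrictions to
each block commute (that is, the stabilizer they generate is separable with respect to `Q`). -/
def CommuteLocally {P : Type} [Fintype P] [DecidableEq P] {k : ℕ}
    (g : Fin k → P → PureExponent d) (Q : Finpartition (Finset.univ : Finset P)) : Prop :=
  ∀ T ∈ Q.parts, ∀ a b, Commute (pauliOp (restrict (g a) T)) (pauliOp (restrict (g b) T))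

/-- The stabilizer generated by the `g a` is inseparable: there is no partition into proper
subsets with respect to which they commute locally. -/
def IsInseparable {P : Type} [Fintype P] [DecidableEq P] {k : ℕ}
    (g : Fin k → P → PureExponent d) : Prop :=
  ¬ ∃ Q : Finpartition (Finset.univ : Finset P), Finset.univ ∉ Q.parts ∧ CommuteLocally g Q

/-- The subspace of the vectors `ψ` with `g a ψ = ψ` for all `a`. -/
def stabilized {P : Type} [Fintype P] [DecidableEq P] {k : ℕ} (g : Fin k → P → PureExponent d) :
    Submodule ℂ (EuclideanSpace ℂ (P → Fin d)) :=
  ⨅ a, Module.End.eigenspace (Matrix.toEuclideanLin (pauliOp (g a))) 1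

/-- The stabilizer generated by the `g a` is complete: it stabilizes a unique pure state. -/
def IsComplete {P : Type} [Fintype P] [DecidableEq P] {k : ℕ}
    (g : Fin k → P → PureExponent d) : Prop :=
  Module.finrank ℂ (stabilized g) = 1

/-- The maximally mixed state over the stabilized subspace: the orthogonal projection onto the
subspace, divided by its trace. -/
def stabilizerState {P : Type} [Fintype P] [DecidableEq P] {k : ℕ}
    (g : Fin k → P → PureExponent d) : Matrix (P → Fin d) (P → Fin d) ℂ :=
  let p : Matrix (P → Fin d) (P → Fin d) ℂ :=
    (Matrix.toEuclideanCLM (n := P → Fin d) (𝕜 := ℂ)).symm (stabilized g).starProjection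
  p.trace⁻¹ • p

/-- `T` is a block, with more than one element, of a partition `Q` into proper subsets such that
the `g a` commute locally with respect to `Q` and their restrictions to `T` generate an
inseparable and complete stabilizer. -/
def IsUnlockingBlock {P : Type} [Fintype P] [DecidableEq P] {k : ℕ}
    (g : Fin k → P → PureExponent d) (Q : Finpartition (Finset.univ : Finset P))
    (T : Finset P) : Prop :=
  Finset.univ ∉ Q.parts ∧ T ∈ Q.parts ∧ 1 < T.card ∧ CommuteLocally g Q ∧
    IsInseparable (fun a => restrict (g a) T) ∧ IsComplete (fun a => restrict (g a) T)

/-- The blocks of the partition `Q` other than `T`. -/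
abbrev OtherBlock {P : Type} [Fintype P] [DecidableEq P]
    (Q : Finpartition (Finset.univ : Finset P)) (T : Finset P) : Type :=
  {U : Finset P // U ∈ Q.parts.erase T}

/-- The operator `I ⊗ ⨂ ⟨b U|`, with the identity on the block `T` and the bra `⟨b U|` on every
other block `U`. -/
def braOnOthers {P : Type} [Fintype P] [DecidableEq P]
    (Q : Finpartition (Finset.univ : Finset P)) (T : Finset P)
    (b : ∀ U : OtherBlock Q T, EuclideanSpace ℂ ({p // p ∈ U.1} → Fin d)) :
    Matrix ({p // p ∈ T} → Fin d) (P → Fin d) ℂ :=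
  Matrix.of fun x z =>
    if ∀ p : {p // p ∈ T}, z p = x p then ∏ U, star (b U fun p => z p) else 0

/-- The unnormalized state of the block `T` after every other block `U` of `Q` has been measured
and found in the pure state `b U`; its trace is the probability of this event. -/
def postMeasurement {P : Type} [Fintype P] [DecidableEq P]
    (Q : Finpartition (Finset.univ : Finset P)) (T : Finset P)
    (b : ∀ U : OtherBlock Q T, EuclideanSpace ℂ ({p // p ∈ U.1} → Fin d))
    (ρ : Matrix (P → Fin d) (P → Fin d) ℂ) :
    Matrix ({p // p ∈ T} → Fin d) ({p // p ∈ T} → Fin d) ℂ :=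
  braOnOthers Q T b * ρ * (braOnOthers Q T b).conjTranspose

/-- If the parties inside each block other than `T` join together, each of these blocks can be
measured in an orthonormal basis in such a way that, whatever outcomes occur, the parties inside
`T` are left with a genuinely multipartite entangled pure state. -/
def LeavesPureEntanglement {P : Type} [Fintype P] [DecidableEq P]
    (Q : Finpartition (Finset.univ : Finset P)) (T : Finset P)
    (ρ : Matrix (P → Fin d) (P → Fin d) ℂ) : Prop :=
  ∃ b : ∀ U : OtherBlock Q T,
      OrthonormalBasis ({p // p ∈ U.1} → Fin d) ℂ (EuclideanSpace ℂ ({p // p ∈ U.1} → Fin d)),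
    ∀ o : ∀ U : OtherBlock Q T, {p // p ∈ U.1} → Fin d,
      (postMeasurement Q T (fun U => b U (o U)) ρ).trace ≠ 0 →
        ∃ ψ : ({p // p ∈ T} → Fin d) → ℂ,
          ∑ x, ‖ψ x‖ ^ 2 = 1 ∧ IsGenuinelyEntangled ψ ∧
          postMeasurement Q T (fun U => b U (o U)) ρ =
            (postMeasurement Q T (fun U => b U (o U)) ρ).trace • Matrix.vecMulVec ψ (star ψ)

end Pauli

end StabilizerBoundEntanglement

end

/-! Two Weyl operators commute up to a phase that is a product of one-qudit phases (`twist`), so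
commuting on a block means that the phases over the block multiply to 1. If a joint eigenvector
factors across a bipartition, its factors are eigenvectors of the restricted operators, which
therefore commute on each side (`prod_twist_eq_one_of_product_eigenvector`).

No distillation: for `i ≠ j` some block `A` contains `i` but not `j`. The generators commute on `A`
and, since they commute globally, on its complement. Products of joint eigenvectors of the two sides
diagonalize the stabilizer projection, so the state is a mixture of product vectors across the cut
(`exists_stabilizerState_eq_sum`). Such mixtures are preserved by taking copies and by LOCC, and by
compactness their fidelity with a fixed entangled state stays below some `μ < 1`
(`exists_pairFidelity_bound`).

Entanglement: a fully separable state would give a full product vector fixed by every generator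
(`IsSeparableState.exists_product_vector`). Then all one-qudit phases would be 1, contradicting
inseparability on a block with more than one qudit.

Unlocking: measuring the qudits outside `T` in a joint eigenbasis leaves `T` in a joint eigenspace
of the restricted generators. Weyl operators span all matrices and permute these eigenspaces, so by
completeness each nonzero one is the line of a Weyl translate of the stabilized vector `φ`
(`exists_weyl_of_eigenvector`). The result is pure, and genuinely entangled by inseparability. The
Weyl correction is local, so after joining parties into two groups that divide `T` one copy yields
`φ` exactly (`isDistillable_group`). -/

noncomputable section

namespace StabilizerBoundEntanglement

open scoped ComplexOrder
open Matrix

/-! ### Tensor products of matrices -/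

section Regroup

variable {P κ : Type} {S : κ → Type}

/-- Regrouping the coordinates of a family according to a division of the index set. -/
def regroup (ι : ∀ k, S k → P) (hι : Function.Bijective fun x : Σ k, S k => ι x.1 x.2)
    (H : P → Type) : (∀ p, H p) ≃ ∀ k, ∀ s : S k, H (ι k s) :=
  (Equiv.piCongrLeft H (Equiv.ofBijective _ hι)).symm.trans
    (Equiv.piCurry fun (k : κ) (s : S k) => H (ι k s))

end Regroup

section Tensor

variable {P : Type} [Fintype P] {H K L : P → Type}

theorem tensor_apply (A : ∀ p, Matrix (H p) (K p) ℂ) (x : ∀ p, H p) (y : ∀ p, K p) :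
    tensor A x y = ∏ p, A p (x p) (y p) := rfl

theorem tensor_mul [DecidableEq P] [∀ p, Fintype (K p)] (A : ∀ p, Matrix (H p) (K p) ℂ)
    (B : ∀ p, Matrix (K p) (L p) ℂ) :
    tensor A * tensor B = tensor fun p => A p * B p := by
  ext x z
  simp only [mul_apply, tensor_apply, Fintype.prod_sum, Finset.prod_mul_distrib]

theorem tensor_conjTranspose (A : ∀ p, Matrix (H p) (K p) ℂ) :
    (tensor A)ᴴ = tensor fun p => (A p)ᴴ := by
  ext x z
  simp [conjTranspose_apply, tensor_apply]

theorem tensor_one [DecidableEq P] [∀ p, DecidableEq (H p)] :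
    tensor (fun p => (1 : Matrix (H p) (H p) ℂ)) = 1 := by
  ext x y
  rw [tensor_apply]
  by_cases h : x = y
  · subst h; simp
  · obtain ⟨p, hp⟩ := Function.ne_iff.1 h
    rw [one_apply_ne h]
    exact Finset.prod_eq_zero (Finset.mem_univ p) (one_apply_ne hp)

theorem tensor_smul (c : P → ℂ) (A : ∀ p, Matrix (H p) (K p) ℂ) :
    tensor (fun p => c p • A p) = (∏ p, c p) • tensor A := by
  ext x y
  simp [tensor_apply, Finset.prod_mul_distrib]

/-- Turns completeness relations of the individual parties into one for their joint outcomes. -/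
theorem sum_tensor [DecidableEq P] {κ : P → Type} [∀ p, Fintype (κ p)]
    (A : ∀ p, κ p → Matrix (H p) (K p) ℂ) :
    ∑ o : ∀ p, κ p, tensor (fun p => A p (o p)) = tensor fun p => ∑ o, A p o := by
  ext x y
  simp [tensor_apply, Matrix.sum_apply, Fintype.prod_sum]

theorem trace_tensor [DecidableEq P] [∀ p, Fintype (H p)] (A : ∀ p, Matrix (H p) (H p) ℂ) :
    (tensor A).trace = ∏ p, (A p).trace := by
  simp [trace, tensor_apply, Fintype.prod_sum]

theorem tensor_pow [DecidableEq P] [∀ p, Fintype (H p)] [∀ p, DecidableEq (H p)]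
    (A : ∀ p, Matrix (H p) (H p) ℂ) (m : ℕ) :
    tensor A ^ m = tensor fun p => A p ^ m := by
  induction m with
  | zero => simp [tensor_one]
  | succ m ih => simp [pow_succ, ih, tensor_mul]

/-- A product operator applied to a product vector with respect to a bipartition. -/
theorem tensor_mulVec_mul [DecidableEq P] [∀ p, Fintype (K p)] (q : P → Prop) [DecidablePred q]
    (A : ∀ p, Matrix (H p) (K p) ℂ) (u : (∀ p : {p // q p}, K p) → ℂ)
    (v : (∀ p : {p // ¬ q p}, K p) → ℂ) :
    tensor A *ᵥ (fun y => u (fun p => y p) * v (fun p => y p)) =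
      fun x => (tensor (fun p : {p // q p} => A p) *ᵥ u) (fun p => x p) *
        (tensor (fun p : {p // ¬ q p} => A p) *ᵥ v) (fun p => x p) := by
  ext x
  simp only [mulVec, dotProduct, tensor_apply]
  rw [Fintype.sum_mul_sum, ← Fintype.sum_prod_type']
  refine Fintype.sum_equiv (Equiv.piEquivPiSubtypeProd q K) _ _ fun y => ?_
  rw [← Fintype.prod_subtype_mul_prod_subtype q]
  simp only [Equiv.piEquivPiSubtypeProd]
  dsimp
  ring

variable {κ : Type} {S : κ → Type}

theorem prod_regroup [Fintype κ] [∀ k, Fintype (S k)] (ι : ∀ k, S k → P)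
    (hι : Function.Bijective fun x : Σ k, S k => ι x.1 x.2) (f : P → ℂ) :
    ∏ p, f p = ∏ k, ∏ s, f (ι k s) := by
  rw [← Fintype.prod_sigma' fun k s => f (ι k s)]
  exact (Fintype.prod_equiv (Equiv.ofBijective _ hι) _ _ fun _ => rfl).symm

/-- A product operator applied to a product vector with respect to a division into groups. -/
theorem tensor_mulVec_prod [DecidableEq P] [∀ p, Fintype (K p)] [Fintype κ] [DecidableEq κ]
    [∀ k, Fintype (S k)] [∀ k, DecidableEq (S k)] (ι : ∀ k, S k → P)
    (hι : Function.Bijective fun x : Σ k, S k => ι x.1 x.2)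
    (A : ∀ p, Matrix (H p) (K p) ℂ) (u : ∀ k, (∀ s, K (ι k s)) → ℂ) :
    tensor A *ᵥ (fun y => ∏ k, u k (fun s => y (ι k s))) =
      fun x => ∏ k, (tensor (fun s => A (ι k s)) *ᵥ u k) (fun s => x (ι k s)) := by
  ext x
  simp only [mulVec, dotProduct, tensor_apply]
  rw [Fintype.prod_sum]
  refine Fintype.sum_equiv (regroup ι hι K) _ _ fun y => ?_
  rw [prod_regroup ι hι, ← Finset.prod_mul_distrib]
  rfl

end Tensor

/-! ### Weyl operators -/

section Weyl

variable {d : ℕ} [NeZero d]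

/-- The root of unity `exp (2πi/d)`. -/
def rootOfUnity (d : ℕ) : ℂ := Complex.exp (2 * Real.pi * Complex.I / d)

theorem isPrimitiveRoot_rootOfUnity : IsPrimitiveRoot (rootOfUnity d) d :=
  Complex.isPrimitiveRoot_exp d (NeZero.ne d)

theorem rootOfUnity_ne_zero : rootOfUnity d ≠ 0 := Complex.exp_ne_zero _

theorem norm_rootOfUnity : ‖rootOfUnity d‖ = 1 :=
  Complex.norm_eq_one_of_pow_eq_one isPrimitiveRoot_rootOfUnity.pow_eq_one (NeZero.ne d)

theorem pauliX_pow_apply (m : ℕ) (a b : Fin d) :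
    (pauliX d ^ m) a b = if a = b + Fin.ofNat d m then 1 else 0 := by
  induction m generalizing a b with
  | zero => simp [one_apply, Fin.ofNat]
  | succ m ih =>
    have h : Fin.ofNat d (m + 1) = 1 + Fin.ofNat d m := by
      ext; simp [Fin.ofNat, Fin.val_add, add_comm]
    simp only [pow_succ, mul_apply, ih, h]
    simp [pauliX, add_assoc, -Fin.ofNat_eq_cast]

theorem pauliX_pow_card : pauliX d ^ d = 1 := by
  ext a b
  have h : Fin.ofNat d d = 0 := by ext; simp [Fin.ofNat]
  simp only [pauliX_pow_apply, h, one_apply, add_zero]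

theorem pauliZ_eq : pauliZ d = diagonal fun j : Fin d => rootOfUnity d ^ (j : ℕ) := rfl

theorem pauliZ_pow (m : ℕ) :
    pauliZ d ^ m = diagonal fun j : Fin d => rootOfUnity d ^ (j * m : ℕ) := by
  rw [pauliZ_eq, diagonal_pow]
  congr 1; funext j; simp [pow_mul]

theorem pauliZ_pow_card : pauliZ d ^ d = 1 := by
  rw [pauliZ_pow, ← diagonal_one]
  congr 1; funext j
  rw [mul_comm, pow_mul, isPrimitiveRoot_rootOfUnity.pow_eq_one, one_pow]

theorem pauliZ_mul_pauliX : pauliZ d * pauliX d = rootOfUnity d • (pauliX d * pauliZ d) := by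
  ext a b
  rw [pauliZ_eq, Matrix.smul_apply, diagonal_mul, mul_diagonal]
  simp only [pauliX, of_apply]
  split_ifs with h
  · subst h
    rw [mul_one, one_mul, smul_eq_mul, ← pow_succ']
    -- At the wraparound the exponents agree only modulo `d`, which is enough for a `d`-th root of
    -- unity.
    exact pow_eq_pow_of_modEq (by
      rw [Fin.val_add, Fin.val_one']
      simp [Nat.ModEq]) isPrimitiveRoot_rootOfUnity.pow_eq_one
  · simp

theorem pauliZ_pow_mul_pauliX_pow (m l : ℕ) :
    pauliZ d ^ m * pauliX d ^ l = rootOfUnity d ^ (m * l) • (pauliX d ^ l * pauliZ d ^ m) := by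
  have h1 : ∀ m : ℕ, pauliZ d ^ m * pauliX d = rootOfUnity d ^ m • (pauliX d * pauliZ d ^ m) := by
    intro m
    induction m with
    | zero => simp
    | succ m ih =>
      rw [pow_succ', mul_assoc, ih, mul_smul_comm, ← mul_assoc, pauliZ_mul_pauliX, smul_mul_assoc,
        smul_smul, mul_assoc, ← pow_succ]
  induction l with
  | zero => simp
  | succ l ih =>
    rw [pow_succ, ← mul_assoc, ih, smul_mul_assoc, mul_assoc, h1, mul_smul_comm, smul_smul,
      ← pow_add, ← mul_assoc, mul_add, mul_one]

/-- `XⁱZʲ` on one qudit. -/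
def weylFactor (d : ℕ) [NeZero d] (e : ℕ × ℕ) : Matrix (Fin d) (Fin d) ℂ :=
  pauliX d ^ e.1 * pauliZ d ^ e.2

/-- The commutation phase of two Weyl operators on one qudit. -/
def twist (d : ℕ) (e f : ℕ × ℕ) : ℂ :=
  rootOfUnity d ^ (e.2 * f.1) * (rootOfUnity d ^ (f.2 * e.1))⁻¹

/-- Both products are powers of the root of unity times the same normal form with added exponents;
`twist` is the quotient of these powers. -/
theorem weylFactor_mul (e f : ℕ × ℕ) :
    weylFactor d e * weylFactor d f = twist d e f • (weylFactor d f * weylFactor d e) := by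
  have h : ∀ e f : ℕ × ℕ, weylFactor d e * weylFactor d f = rootOfUnity d ^ (e.2 * f.1) •
      (pauliX d ^ (e.1 + f.1) * pauliZ d ^ (e.2 + f.2)) := by
    intro e f
    rw [weylFactor, weylFactor, mul_assoc, ← mul_assoc (pauliZ d ^ e.2),
      pauliZ_pow_mul_pauliX_pow, smul_mul_assoc, mul_smul_comm, mul_assoc (pauliX d ^ f.1),
      ← pow_add, ← mul_assoc, ← pow_add]
  rw [h, h, smul_smul, twist, inv_mul_cancel_right₀ (pow_ne_zero _ rootOfUnity_ne_zero),
    add_comm e.1, add_comm e.2]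

theorem pauliX_conjTranspose_mul : (pauliX d)ᴴ * pauliX d = 1 := by
  ext a b
  simp only [mul_apply, conjTranspose_apply, pauliX, of_apply, one_apply]
  simp [eq_comm]

theorem pauliZ_conjTranspose_mul : (pauliZ d)ᴴ * pauliZ d = 1 := by
  rw [pauliZ_eq, diagonal_conjTranspose, diagonal_mul_diagonal, ← diagonal_one]
  congr 1; funext j
  have := Complex.conj_mul' (rootOfUnity d ^ (j : ℕ))
  simpa [norm_rootOfUnity] using this

theorem weylFactor_conjTranspose_mul (e : ℕ × ℕ) :
    (weylFactor d e)ᴴ * weylFactor d e = 1 := by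
  have h : ∀ (A : Matrix (Fin d) (Fin d) ℂ), Aᴴ * A = 1 → ∀ m : ℕ, (A ^ m)ᴴ * A ^ m = 1 := by
    intro A hA m
    have : A ∈ unitaryGroup (Fin d) ℂ := mem_unitaryGroup_iff'.2 hA
    exact mem_unitaryGroup_iff'.1 (pow_mem this m)
  rw [weylFactor, conjTranspose_mul, mul_assoc, ← mul_assoc _ (pauliX d ^ e.1),
    h _ pauliX_conjTranspose_mul, one_mul, h _ pauliZ_conjTranspose_mul]

/-- Every matrix unit is a combination of Weyl operators. -/
theorem exists_sum_weylFactor (x y : Fin d) :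
    ∃ (s : ℕ) (c : Fin d → ℂ), ∑ t, c t • weylFactor d (s, (t : ℕ)) = single x y 1 := by
  -- Inverse discrete Fourier transform: these coefficients combine the powers of `Z` into the
  -- projection onto the basis vector `y`, which the shift by `x - y` carries to the matrix unit.
  refine ⟨(x - y : Fin d), fun t => (d : ℂ)⁻¹ * (rootOfUnity d ^ (y * t : ℕ))⁻¹, ?_⟩
  have hd : (d : ℂ) ≠ 0 := Nat.cast_ne_zero.2 (NeZero.ne d)
  have key : ∑ t : Fin d, ((d : ℂ)⁻¹ * (rootOfUnity d ^ (y * t : ℕ))⁻¹) • pauliZ d ^ (t : ℕ) =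
      single y y 1 := by
    ext a b
    simp only [Matrix.sum_apply, Matrix.smul_apply, pauliZ_pow, diagonal_apply, single_apply, smul_eq_mul]
    by_cases hab : a = b
    · subst hab
      simp only [if_true, and_self]
      have hterm : ∀ t : Fin d, (d : ℂ)⁻¹ * (rootOfUnity d ^ (y * t : ℕ))⁻¹ *
          rootOfUnity d ^ (a * t : ℕ) =
          (d : ℂ)⁻¹ * ((rootOfUnity d ^ (a : ℕ) / rootOfUnity d ^ (y : ℕ)) ^ (t : ℕ)) := by
        intro t; rw [pow_mul, pow_mul, div_pow]; ring
      rw [Finset.sum_congr rfl fun t _ => hterm t, ← Finset.mul_sum,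
        Fin.sum_univ_eq_sum_range fun t =>
          (rootOfUnity d ^ (a : ℕ) / rootOfUnity d ^ (y : ℕ)) ^ t]
      by_cases hya : y = a
      · subst hya
        simp [div_self (pow_ne_zero _ rootOfUnity_ne_zero), hd]
      · rw [if_neg hya]
        have hne : rootOfUnity d ^ (a : ℕ) / rootOfUnity d ^ (y : ℕ) ≠ 1 := by
          rw [Ne, div_eq_one_iff_eq (pow_ne_zero _ rootOfUnity_ne_zero)]
          intro h
          exact hya (Fin.ext (isPrimitiveRoot_rootOfUnity.pow_inj a.2 y.2 h)).symm
        rw [geom_sum_eq hne, div_pow, ← pow_mul, ← pow_mul, mul_comm (a : ℕ), mul_comm (y : ℕ),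
          pow_mul, pow_mul, isPrimitiveRoot_rootOfUnity.pow_eq_one]
        simp
    · have : ¬ (y = a ∧ y = b) := fun h => hab (h.1.symm.trans h.2)
      simp [hab, this]
  have hX : pauliX d ^ ((x - y : Fin d) : ℕ) * single y y (1 : ℂ) = single x y 1 := by
    have hs : Fin.ofNat d ((x - y : Fin d) : ℕ) = x - y :=
      Fin.ext (Nat.mod_eq_of_lt (x - y).2)
    ext a b
    rw [single_apply]
    by_cases hb : b = y
    · subst hb
      rw [mul_single_apply_same, pauliX_pow_apply, hs]
      simp [eq_comm]
    · rw [mul_single_apply_of_ne _ _ _ _ _ hb, if_neg (fun h => hb h.2.symm)]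
  simp only [weylFactor]
  rw [← hX, ← key, Finset.mul_sum]
  simp

/-! ### Weyl operators on several qudits -/

variable {P : Type} [Fintype P]

/-- The Weyl operator with the given exponents. -/
def weyl (d : ℕ) [NeZero d] (e : P → ℕ × ℕ) : Matrix (P → Fin d) (P → Fin d) ℂ :=
  tensor fun p => weylFactor d (e p)

/-- The exponents of an element of `G'` as natural numbers. -/
def exponents (g : P → PureExponent d) : P → ℕ × ℕ := fun p => ((g p).1.1, (g p).1.2)

theorem pauliOp_eq_weyl (g : P → PureExponent d) : pauliOp g = weyl d (exponents g) := rfl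

/-- Purity of the exponents matters: for `d = 2` the square of `XZ` is `-1`. -/
theorem sigma_pow_card (e : PureExponent d) : sigma e ^ d = 1 := by
  obtain ⟨⟨i, j⟩, h⟩ := e
  have h' : i = 0 ∨ j = 0 := h
  rcases h' with rfl | rfl <;>
    simp [sigma, ← pow_mul, mul_comm _ d] <;>
    simp [pow_mul, pauliX_pow_card, pauliZ_pow_card]

variable [DecidableEq P]

theorem weyl_conjTranspose_mul (e : P → ℕ × ℕ) : (weyl d e)ᴴ * weyl d e = 1 := by
  rw [weyl, tensor_conjTranspose, tensor_mul]
  simp [weylFactor_conjTranspose_mul, tensor_one]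

theorem weyl_mul_conjTranspose (e : P → ℕ × ℕ) : weyl d e * (weyl d e)ᴴ = 1 :=
  mul_eq_one_comm.1 (weyl_conjTranspose_mul e)

theorem weyl_mul (e f : P → ℕ × ℕ) :
    weyl d e * weyl d f = (∏ p, twist d (e p) (f p)) • (weyl d f * weyl d e) := by
  simp only [weyl, tensor_mul, ← tensor_smul]
  congr 1; funext p
  exact weylFactor_mul _ _

theorem weyl_mulVec_injective (e : P → ℕ × ℕ) {u v : (P → Fin d) → ℂ}
    (h : weyl d e *ᵥ u = weyl d e *ᵥ v) : u = v := by
  have := congrArg (fun w => (weyl d e)ᴴ *ᵥ w) h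
  simpa [mulVec_mulVec, weyl_conjTranspose_mul] using this

theorem weyl_mulVec_ne_zero (e : P → ℕ × ℕ) {u : (P → Fin d) → ℂ} (hu : u ≠ 0) :
    weyl d e *ᵥ u ≠ 0 := fun h =>
  hu (weyl_mulVec_injective e (by rw [h, mulVec_zero]))

theorem weyl_eigenvalue_ne_zero {e : P → ℕ × ℕ} {u : (P → Fin d) → ℂ} (hu : u ≠ 0) {c : ℂ}
    (h : weyl d e *ᵥ u = c • u) : c ≠ 0 := by
  rintro rfl
  exact weyl_mulVec_ne_zero e hu (by rw [h, zero_smul])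

/-- Weyl operators with a common eigenvector commute. -/
theorem prod_twist_eq_one_of_eigenvector {e f : P → ℕ × ℕ} {u : (P → Fin d) → ℂ} (hu : u ≠ 0)
    {a b : ℂ} (he : weyl d e *ᵥ u = a • u) (hf : weyl d f *ᵥ u = b • u) :
    ∏ p, twist d (e p) (f p) = 1 := by
  have ha := weyl_eigenvalue_ne_zero hu he
  have hb := weyl_eigenvalue_ne_zero hu hf
  have h := congrArg (fun M => M *ᵥ u) (weyl_mul (d := d) e f)
  simp only [smul_mulVec, ← mulVec_mulVec, he, hf, mulVec_smul, smul_smul] at h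
  have h2 := smul_left_injective ℂ hu h
  have hab : a * b ≠ 0 := mul_ne_zero ha hb
  apply mul_right_cancel₀ hab
  rw [one_mul]
  linear_combination -h2

/-- Weyl operators are invertible, so commuting operators can be cancelled from the exchange
relation, leaving the phase times the identity. -/
theorem commute_weyl_iff (e f : P → ℕ × ℕ) :
    Commute (weyl d e) (weyl d f) ↔ ∏ p, twist d (e p) (f p) = 1 := by
  rw [Commute, SemiconjBy, weyl_mul]
  constructor
  · intro h
    have h2 : (∏ p, twist d (e p) (f p)) • (1 : Matrix (P → Fin d) (P → Fin d) ℂ) = 1 := by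
      have := congrArg (fun M => M * ((weyl d e)ᴴ * (weyl d f)ᴴ)) h
      have h3 : weyl d f * weyl d e * ((weyl d e)ᴴ * (weyl d f)ᴴ) = 1 := by
        rw [mul_assoc, ← mul_assoc (weyl d e), weyl_mul_conjTranspose, one_mul,
          weyl_mul_conjTranspose]
      simpa only [smul_mul_assoc, h3] using this
    have h3 := congrFun (congrFun h2 (fun _ => 0)) (fun _ => 0)
    simpa using h3
  · intro h
    rw [h, one_smul]

theorem commute_pauliOp_iff (g h : P → PureExponent d) :
    Commute (pauliOp g) (pauliOp h) ↔ ∏ p, twist d (exponents g p) (exponents h p) = 1 := by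
  rw [pauliOp_eq_weyl, pauliOp_eq_weyl, commute_weyl_iff]

theorem commute_pauliOp_restrict_iff (g h : P → PureExponent d) (T : Finset P) :
    Commute (pauliOp (restrict g T)) (pauliOp (restrict h T)) ↔
      ∏ p ∈ T, twist d (exponents g p) (exponents h p) = 1 := by
  rw [commute_pauliOp_iff, ← Finset.prod_coe_sort T]
  rfl

theorem pauliOp_pow_card (g : P → PureExponent d) : pauliOp g ^ d = 1 := by
  simp [pauliOp, tensor_pow, sigma_pow_card, tensor_one]

/-- Some Weyl operator has a nonzero matrix element between two given nonzero vectors. -/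
theorem exists_weyl_dotProduct_ne_zero {u v : (P → Fin d) → ℂ} (hu : u ≠ 0) (hv : v ≠ 0) :
    ∃ e : P → ℕ × ℕ, star u ⬝ᵥ (weyl d e *ᵥ v) ≠ 0 := by
  obtain ⟨x, hx⟩ := Function.ne_iff.1 hu
  obtain ⟨y, hy⟩ := Function.ne_iff.1 hv
  choose s c hsc using fun p => exists_sum_weylFactor (x p) (y p)
  -- The tensor product of the one-qudit expansions expresses the matrix unit at `(x, y)` by Weyl
  -- operators; its matrix element `star (u x) * v y` is nonzero, so not all the Weyl ones vanish.
  have hsum : ∑ t : P → Fin d, (∏ p, c p (t p)) • weyl d (fun p => (s p, (t p : ℕ))) =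
      single x y 1 := by
    have h1 : ∀ t : P → Fin d, (∏ p, c p (t p)) • weyl d (fun p => (s p, (t p : ℕ))) =
        tensor fun p => c p (t p) • weylFactor d (s p, (t p : ℕ)) := fun t => by
      rw [tensor_smul, weyl]
    rw [Finset.sum_congr rfl fun t _ => h1 t,
      sum_tensor (fun p t => c p t • weylFactor d (s p, (t : ℕ)))]
    simp only [hsc]
    ext a b
    simp only [tensor_apply, single_apply]
    rw [Finset.prod_ite_zero]
    simp [funext_iff, forall_and]
  by_contra! hcon
  have h0 : star u ⬝ᵥ (single x y 1 *ᵥ v) = 0 := by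
    rw [← hsum, sum_mulVec, dotProduct_sum]
    refine Finset.sum_eq_zero fun t _ => ?_
    rw [smul_mulVec, dotProduct_smul, hcon, smul_zero]
  have h1 : star u ⬝ᵥ (single x y 1 *ᵥ v) = star (u x) * v y := by
    simp [dotProduct, single_mulVec, Function.update_apply]
  rw [h1] at h0
  exact mul_ne_zero (star_ne_zero.2 hx) hy h0

end Weyl

/-! ### Joint eigenbases -/

section Eigenbasis

-- Each operator is annihilated by the separable polynomial `X ^ m - 1`, hence is semisimple. Its
-- generalized eigenspaces are then eigenspaces, and the decomposition for commuting families
-- applies.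
open Module.End in
theorem iSup_iInf_eigenspace_eq_top {E ι : Type*} [AddCommGroup E] [Module ℂ E]
    [FiniteDimensional ℂ E] (T : ι → Module.End ℂ E) (hT : ∀ i j, Commute (T i) (T j))
    {m : ℕ} (hm : m ≠ 0) (hpow : ∀ i, T i ^ m = 1) :
    ⨆ χ : ι → ℂ, ⨅ i, eigenspace (T i) (χ i) = ⊤ := by
  have hs : ∀ i, (T i).IsFinitelySemisimple := fun i => by
    refine (isSemisimple_of_squarefree_aeval_eq_zero (p := Polynomial.X ^ m - Polynomial.C 1)
      ?_ ?_).isFinitelySemisimple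
    · exact (Polynomial.separable_X_pow_sub_C 1 (Nat.cast_ne_zero.2 hm) one_ne_zero).squarefree
    · simp [hpow]
  have h := iSup_iInf_maxGenEigenspace_eq_top_of_iSup_maxGenEigenspace_eq_top_of_commute T
    (fun i j _ => hT i j) (fun i => iSup_maxGenEigenspace_eq_top (T i))
  simpa only [(hs _).maxGenEigenspace_eq_eigenspace] using h

/-- For `x ≠ 0` the isometry gives `conj a * a = 1`; a nonzero inner product would also give `conj a
* b = 1`, hence `a = b`. -/
theorem inner_eq_zero_of_eigenvectors {E : Type*} [NormedAddCommGroup E] [InnerProductSpace ℂ E]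
    (T : Module.End ℂ E) (hT : ∀ x y, inner ℂ (T x) (T y) = inner ℂ x y) {x y : E} {a b : ℂ}
    (hx : T x = a • x) (hy : T y = b • y) (hab : a ≠ b) : inner ℂ x y = 0 := by
  by_cases hx0 : x = 0
  · simp [hx0]
  have hxx := hT x x
  rw [hx, inner_smul_left, inner_smul_right, ← mul_assoc] at hxx
  have ha : (starRingEnd ℂ) a * a = 1 :=
    mul_right_cancel₀ (inner_self_ne_zero.2 hx0) (by rw [hxx, one_mul])
  have hxy := hT x y
  rw [hx, hy, inner_smul_left, inner_smul_right, ← mul_assoc] at hxy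
  by_contra h
  have hb : (starRingEnd ℂ) a * b = 1 := mul_right_cancel₀ h (by rw [hxy, one_mul])
  have ha0 : (starRingEnd ℂ) a ≠ 0 := left_ne_zero_of_mul (a := (starRingEnd ℂ) a) (b := a)
    (by rw [ha]; exact one_ne_zero)
  exact hab (mul_left_cancel₀ ha0 (by rw [ha, hb]))

-- Distinct joint eigenspaces are orthogonal and together span, so orthonormal bases of them combine
-- into one of the whole space.
open Module.End in
theorem exists_orthonormalBasis_joint_eigenvectors {E I ι : Type*} [Fintype I]
    [NormedAddCommGroup E] [InnerProductSpace ℂ E] [FiniteDimensional ℂ E]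
    (hI : Module.finrank ℂ E = Fintype.card I)
    (T : ι → Module.End ℂ E) (hT : ∀ i j, Commute (T i) (T j))
    (hTinner : ∀ a x y, inner ℂ (T a x) (T a y) = inner ℂ x y)
    {m : ℕ} (hm : m ≠ 0) (hpow : ∀ i, T i ^ m = 1) :
    ∃ b : OrthonormalBasis I ℂ E, ∀ i a, ∃ c : ℂ, T a (b i) = c • b i := by
  let V : (ι → ℂ) → Submodule ℂ E := fun χ => ⨅ a, eigenspace (T a) (χ a)
  have htop : ⨆ χ, V χ = ⊤ := iSup_iInf_eigenspace_eq_top T hT hm hpow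
  have hmem : ∀ χ x, x ∈ V χ → ∀ a, T a x = χ a • x := fun χ x hx a =>
    mem_eigenspace_iff.1 ((Submodule.mem_iInf _).1 hx a)
  have hfam : OrthogonalFamily ℂ (fun χ => V χ) fun χ => (V χ).subtypeₗᵢ := by
    intro χ₁ χ₂ hne x y
    obtain ⟨a, ha⟩ := Function.ne_iff.1 hne
    exact inner_eq_zero_of_eigenvectors (T a) (hTinner a) (hmem _ _ x.2 a) (hmem _ _ y.2 a) ha
  let v : (Σ χ, Fin (Module.finrank ℂ (V χ))) → E :=
    fun s => (stdOrthonormalBasis ℂ (V s.1) s.2 : E)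
  have hon : Orthonormal ℂ v :=
    hfam.orthonormal_sigma_orthonormal fun χ => (stdOrthonormalBasis ℂ (V χ)).orthonormal
  have hspan : ⊤ ≤ Submodule.span ℂ (Set.range v) := by
    rw [← htop]
    refine iSup_le fun χ => ?_
    intro x hx
    have h2 := (stdOrthonormalBasis ℂ (V χ)).toBasis.span_eq
    have h3 : (⟨x, hx⟩ : V χ) ∈ Submodule.span ℂ
      (Set.range (stdOrthonormalBasis ℂ (V χ)).toBasis) := by rw [h2]; trivial
    have h4 := Submodule.mem_map_of_mem (f := (V χ).subtype) h3
    rw [Submodule.map_span] at h4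
    refine Submodule.span_mono ?_ h4
    rintro _ ⟨_, ⟨j, rfl⟩, rfl⟩
    exact ⟨⟨χ, j⟩, by simp [v]⟩
  have : Finite (Σ χ, Fin (Module.finrank ℂ (V χ))) := hon.linearIndependent.finite
  let _ : Fintype (Σ χ, Fin (Module.finrank ℂ (V χ))) := Fintype.ofFinite _
  let b₀ := OrthonormalBasis.mk hon hspan
  have hcard : Fintype.card (Σ χ, Fin (Module.finrank ℂ (V χ))) = Fintype.card I := by
    rw [← Module.finrank_eq_card_basis b₀.toBasis, hI]
  refine ⟨b₀.reindex (Fintype.equivOfCardEq hcard), fun i a => ?_⟩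
  rw [OrthonormalBasis.reindex_apply, OrthonormalBasis.coe_mk]
  exact ⟨_, hmem _ _ (stdOrthonormalBasis ℂ (V _) _).2 a⟩

theorem exists_orthonormalBasis_eigenvectors {I ι : Type*} [Fintype I] [DecidableEq I]
    (M : ι → Matrix I I ℂ) (hM : ∀ a b, Commute (M a) (M b)) (hU : ∀ a, (M a)ᴴ * M a = 1)
    {m : ℕ} (hm : m ≠ 0) (hpow : ∀ a, M a ^ m = 1) :
    ∃ b : OrthonormalBasis I ℂ (EuclideanSpace ℂ I),
      ∀ i a, ∃ c : ℂ, M a *ᵥ (b i).ofLp = c • (b i).ofLp := by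
  obtain ⟨φ, hφ⟩ : ∃ φ : Matrix I I ℂ →* Module.End ℂ (EuclideanSpace ℂ I),
      ∀ A, φ A = toEuclideanLin A :=
    ⟨{ toFun := fun A => toEuclideanLin A
       map_one' := by ext x; simp
       map_mul' := fun A B => by ext x; simp [toLpLin_apply, mulVec_mulVec] }, fun _ => rfl⟩
  have hinner : ∀ a x y, inner ℂ (φ (M a) x) (φ (M a) y) = inner ℂ x y := fun a x y => by
    have h : LinearMap.adjoint (φ (M a)) = φ (M a)ᴴ := by
      rw [hφ, hφ, toEuclideanLin_conjTranspose_eq_adjoint]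
    rw [← LinearMap.adjoint_inner_right, h, ← Module.End.mul_apply, ← map_mul, hU, map_one,
      Module.End.one_apply]
  have hrank : Module.finrank ℂ (EuclideanSpace ℂ I) = Fintype.card I := finrank_euclideanSpace
  have hcomm : ∀ a b, φ (M a) * φ (M b) = φ (M b) * φ (M a) := fun a b => by
    rw [← map_mul, ← map_mul, (hM a b).eq]
  have hφpow : ∀ a, φ (M a) ^ m = 1 := fun a => by rw [← map_pow, hpow, map_one]
  obtain ⟨b, hb⟩ := exists_orthonormalBasis_joint_eigenvectors hrank
    (fun a => φ (M a)) hcomm hinner hm hφpow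
  refine ⟨b, fun i a => ?_⟩
  obtain ⟨c, hc⟩ := hb i a
  rw [hφ, toLpLin_apply] at hc
  exact ⟨c, by simpa using congrArg WithLp.ofLp hc⟩

theorem sum_vecMulVec_orthonormalBasis {I κ : Type*} [Fintype I] [DecidableEq I] [Fintype κ]
    (b : OrthonormalBasis κ ℂ (EuclideanSpace ℂ I)) :
    ∑ i, vecMulVec (b i).ofLp (star (b i).ofLp) = 1 := by
  ext x y
  have h := congrArg (fun v : EuclideanSpace ℂ I => v x)
    (b.sum_repr' (EuclideanSpace.single y (1 : ℂ)))
  simp only [Matrix.sum_apply, vecMulVec_apply, Pi.star_apply]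
  simpa [one_apply, EuclideanSpace.inner_single_right, mul_comm, Finset.sum_apply, eq_comm] using h

variable {d : ℕ} [NeZero d] {P : Type} [Fintype P] [DecidableEq P] {k : ℕ}

theorem exists_orthonormalBasis_pauliOp (g : Fin k → P → PureExponent d)
    (hg : ∀ a b, Commute (pauliOp (g a)) (pauliOp (g b))) :
    ∃ b : OrthonormalBasis (P → Fin d) ℂ (EuclideanSpace ℂ (P → Fin d)),
      ∀ i a, ∃ c : ℂ, pauliOp (g a) *ᵥ (b i).ofLp = c • (b i).ofLp :=
  exists_orthonormalBasis_eigenvectors _ hg (fun a => weyl_conjTranspose_mul (exponents (g a)))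
    (NeZero.ne d) fun a => pauliOp_pow_card (g a)

end Eigenbasis

/-! ### Stabilized subspaces -/

section Stabilized

variable {d : ℕ} [NeZero d] {P : Type} [Fintype P] [DecidableEq P] {k : ℕ}

theorem mem_stabilized_iff {g : Fin k → P → PureExponent d}
    {v : EuclideanSpace ℂ (P → Fin d)} :
    v ∈ stabilized g ↔ ∀ a, pauliOp (g a) *ᵥ v.ofLp = v.ofLp := by
  simp only [stabilized, Submodule.mem_iInf, Module.End.mem_eigenspace_iff, one_smul,
    toLpLin_apply]
  exact forall_congr' fun a => ⟨fun h => congrArg WithLp.ofLp h, fun h => by rw [h]⟩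

/-- The orthogonal projection onto the stabilized subspace. -/
def stabilizerProj (g : Fin k → P → PureExponent d) : Matrix (P → Fin d) (P → Fin d) ℂ :=
  (toEuclideanCLM (n := P → Fin d) (𝕜 := ℂ)).symm (stabilized g).starProjection

theorem stabilizerState_eq (g : Fin k → P → PureExponent d) :
    stabilizerState g = (stabilizerProj g).trace⁻¹ • stabilizerProj g := rfl

theorem stabilizerProj_mulVec (g : Fin k → P → PureExponent d) (v : (P → Fin d) → ℂ) :
    stabilizerProj g *ᵥ v = ((stabilized g).starProjection (WithLp.toLp 2 v)).ofLp := by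
  have h : toEuclideanCLM (n := P → Fin d) (𝕜 := ℂ) (stabilizerProj g) =
    (stabilized g).starProjection := StarAlgEquiv.apply_symm_apply _ _
  rw [← h, ofLp_toEuclideanCLM]

theorem stabilizerProj_mulVec_of_fixed {g : Fin k → P → PureExponent d} {v : (P → Fin d) → ℂ}
    (hv : ∀ a, pauliOp (g a) *ᵥ v = v) : stabilizerProj g *ᵥ v = v := by
  rw [stabilizerProj_mulVec, Submodule.starProjection_eq_self_iff.2 (mem_stabilized_iff.2 hv)]

theorem stabilizerProj_mulVec_fixed (g : Fin k → P → PureExponent d) (v : (P → Fin d) → ℂ)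
    (a : Fin k) : pauliOp (g a) *ᵥ (stabilizerProj g *ᵥ v) = stabilizerProj g *ᵥ v := by
  rw [stabilizerProj_mulVec]
  exact mem_stabilized_iff.1 (Submodule.starProjection_apply_mem _ _) a

theorem pauliOp_mul_stabilizerProj (g : Fin k → P → PureExponent d) (a : Fin k) :
    pauliOp (g a) * stabilizerProj g = stabilizerProj g := by
  refine ext_of_mulVec_single fun i => ?_
  rw [← mulVec_mulVec, stabilizerProj_mulVec_fixed]

theorem stabilizerProj_mul_self (g : Fin k → P → PureExponent d) :
    stabilizerProj g * stabilizerProj g = stabilizerProj g := by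
  refine ext_of_mulVec_single fun i => ?_
  rw [← mulVec_mulVec, stabilizerProj_mulVec_of_fixed (stabilizerProj_mulVec_fixed g _)]

theorem stabilizerProj_conjTranspose (g : Fin k → P → PureExponent d) :
    (stabilizerProj g)ᴴ = stabilizerProj g := by
  have h : (toEuclideanCLM (n := P → Fin d) (𝕜 := ℂ)).symm (star (stabilized g).starProjection) =
    star ((toEuclideanCLM (n := P → Fin d) (𝕜 := ℂ)).symm (stabilized g).starProjection) :=
    (toEuclideanCLM (n := P → Fin d) (𝕜 := ℂ)).symm.map_star' _
  have h2 : star (stabilized g).starProjection = (stabilized g).starProjection :=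
    isSelfAdjoint_starProjection (stabilized g)
  rw [h2] at h
  exact h.symm

/-- The unitary `g a` fixes the range of the Hermitian projection, so the projection also absorbs `g
a` on the right. Hence the image of `v` equals `c` times itself. -/
theorem stabilizerProj_mulVec_eq_zero {g : Fin k → P → PureExponent d} {v : (P → Fin d) → ℂ}
    {a : Fin k} {c : ℂ} (hv : pauliOp (g a) *ᵥ v = c • v) (hc : c ≠ 1) :
    stabilizerProj g *ᵥ v = 0 := by
  have h1 : stabilizerProj g * pauliOp (g a) = stabilizerProj g := by
    have h2 := congrArg (fun M => (weyl d (exponents (g a)))ᴴ * M) (pauliOp_mul_stabilizerProj g a)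
    rw [pauliOp_eq_weyl, ← mul_assoc, weyl_conjTranspose_mul, one_mul] at h2
    have h3 := congrArg conjTranspose h2
    rw [conjTranspose_mul, conjTranspose_conjTranspose, stabilizerProj_conjTranspose] at h3
    rw [pauliOp_eq_weyl, ← h3]
  have h4 : stabilizerProj g *ᵥ v = c • (stabilizerProj g *ᵥ v) := by
    conv_lhs => rw [← h1, ← mulVec_mulVec, hv, mulVec_smul]
  have h5 : (1 - c) • (stabilizerProj g *ᵥ v) = 0 := by
    rw [sub_smul, one_smul, ← h4, sub_self]
  exact (smul_eq_zero.1 h5).resolve_left (sub_ne_zero.2 hc.symm)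

theorem stabilizerProj_posSemidef (g : Fin k → P → PureExponent d) :
    (stabilizerProj g).PosSemidef := by
  have h := posSemidef_conjTranspose_mul_self (stabilizerProj g)
  rwa [stabilizerProj_conjTranspose, stabilizerProj_mul_self] at h

theorem stabilizerProj_trace_ne_zero {g : Fin k → P → PureExponent d} (hV : stabilized g ≠ ⊥) :
    (stabilizerProj g).trace ≠ 0 := by
  intro h
  rw [(stabilizerProj_posSemidef g).trace_eq_zero_iff] at h
  obtain ⟨v, hv, hv0⟩ := Submodule.exists_mem_ne_zero_of_ne_bot hV
  have h2 := stabilizerProj_mulVec_of_fixed (mem_stabilized_iff.1 hv)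
  rw [h, zero_mulVec] at h2
  exact hv0 (by ext x; exact (congrFun h2 x).symm)

theorem isDensity_stabilizerState {g : Fin k → P → PureExponent d} (hV : stabilized g ≠ ⊥) :
    IsDensity (stabilizerState g) := by
  have h := stabilizerProj_trace_ne_zero hV
  have hp := stabilizerProj_posSemidef g
  refine ⟨?_, ?_⟩
  · rw [stabilizerState_eq]
    exact hp.smul (inv_nonneg.2 hp.trace_nonneg)
  · rw [stabilizerState_eq, trace_smul, smul_eq_mul, inv_mul_cancel₀ h]

theorem pauliOp_mul_stabilizerState (g : Fin k → P → PureExponent d) (a : Fin k) :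
    pauliOp (g a) * stabilizerState g = stabilizerState g := by
  rw [stabilizerState_eq, mul_smul_comm, pauliOp_mul_stabilizerProj]

/-- The stabilized subspace of a complete stabilizer is the line of a unit vector. -/
theorem IsComplete.exists_unit_vector {g : Fin k → P → PureExponent d} (hg : IsComplete g) :
    ∃ φ : (P → Fin d) → ℂ, star φ ⬝ᵥ φ = 1 ∧ (∀ a, pauliOp (g a) *ᵥ φ = φ) ∧
      ∀ v, (∀ a, pauliOp (g a) *ᵥ v = v) → ∃ c : ℂ, v = c • φ := by
  obtain ⟨b⟩ : Nonempty (OrthonormalBasis (Fin 1) ℂ (stabilized g)) :=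
    ⟨(stdOrthonormalBasis ℂ (stabilized g)).reindex (finCongr hg)⟩
  refine ⟨(b 0 : EuclideanSpace ℂ (P → Fin d)).ofLp, ?_, mem_stabilized_iff.1 (b 0).2, ?_⟩
  · have h := inner_self_eq_norm_sq_to_K (𝕜 := ℂ) (b 0)
    rw [b.orthonormal.1 0, Submodule.coe_inner, EuclideanSpace.inner_eq_star_dotProduct,
      dotProduct_comm] at h
    simpa using h
  · intro v hv
    have h := b.sum_repr ⟨WithLp.toLp 2 v, mem_stabilized_iff.2 hv⟩
    rw [Fin.sum_univ_one] at h
    exact ⟨_, (congrArg (fun w : stabilized g => (w : EuclideanSpace ℂ (P → Fin d)).ofLp) h).symm⟩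

theorem weyl_mulVec_weyl_mulVec (e f : P → ℕ × ℕ) (v : (P → Fin d) → ℂ) :
    weyl d e *ᵥ (weyl d f *ᵥ v) =
      (∏ p, twist d (e p) (f p)) • (weyl d f *ᵥ (weyl d e *ᵥ v)) := by
  rw [mulVec_mulVec, weyl_mul, smul_mulVec, mulVec_mulVec]

theorem star_weyl_dotProduct_weyl (e : P → ℕ × ℕ) (u v : (P → Fin d) → ℂ) :
    star (weyl d e *ᵥ u) ⬝ᵥ (weyl d e *ᵥ v) = star u ⬝ᵥ v := by
  rw [star_mulVec, ← dotProduct_mulVec, mulVec_mulVec, weyl_conjTranspose_mul, one_mulVec]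

/-- If the stabilizer is complete, all its joint eigenspaces are images of the stabilized line
under Weyl operators. -/
theorem exists_weyl_of_eigenvector {g : Fin k → P → PureExponent d} {φ ψ : (P → Fin d) → ℂ}
    (hφ : φ ≠ 0) (hfix : ∀ a, pauliOp (g a) *ᵥ φ = φ)
    (hline : ∀ v, (∀ a, pauliOp (g a) *ᵥ v = v) → ∃ c : ℂ, v = c • φ) (hψ : ψ ≠ 0)
    {χ : Fin k → ℂ} (hχ : ∀ a, pauliOp (g a) *ᵥ ψ = χ a • ψ) :
    ∃ e : P → ℕ × ℕ, ∀ v, (∀ a, pauliOp (g a) *ᵥ v = χ a • v) →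
      ∃ c : ℂ, v = c • (weyl d e *ᵥ φ) := by
  -- A translate of `φ` overlapping `ψ` must lie in the same joint eigenspace as `ψ`.
  obtain ⟨e, he⟩ := exists_weyl_dotProduct_ne_zero (d := d) hψ hφ
  refine ⟨e, fun v hv => ?_⟩
  -- The translate is an eigenvector with the product of twists as eigenvalue. Unitarity and the
  -- nonzero overlap force this to equal `χ a`.
  have hτ : ∀ a, ∏ p, twist d (exponents (g a) p) (e p) = χ a := fun a => by
    have h1 := star_weyl_dotProduct_weyl (exponents (g a)) ψ (weyl d e *ᵥ φ)
    have h2 := star_weyl_dotProduct_weyl (exponents (g a)) ψ ψ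
    rw [weyl_mulVec_weyl_mulVec, ← pauliOp_eq_weyl, hχ, hfix, star_smul, smul_dotProduct,
      dotProduct_smul, smul_smul, smul_eq_mul] at h1
    rw [← pauliOp_eq_weyl, hχ, star_smul, smul_dotProduct, dotProduct_smul, smul_smul,
      smul_eq_mul] at h2
    have h3 := mul_right_cancel₀ he (h1.trans (one_mul _).symm)
    have h4 := mul_right_cancel₀ (dotProduct_star_self_eq_zero.not.2 hψ ∘ by
      rw [dotProduct_comm]; exact id) (h2.trans (one_mul _).symm)
    have h5 : star (χ a) ≠ 0 := left_ne_zero_of_mul (b := χ a) (by rw [h4]; exact one_ne_zero)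
    exact mul_left_cancel₀ h5 (h3.trans h4.symm)
  have hWv : weyl d e *ᵥ ((weyl d e)ᴴ *ᵥ v) = v := by
    rw [mulVec_mulVec, weyl_mul_conjTranspose, one_mulVec]
  -- Conversely, the inverse translation carries the whole `χ`-eigenspace into the stabilized line.
  obtain ⟨c, hc⟩ := hline ((weyl d e)ᴴ *ᵥ v) fun a => by
    have h := weyl_mulVec_weyl_mulVec (d := d) (exponents (g a)) e ((weyl d e)ᴴ *ᵥ v)
    rw [hWv, ← pauliOp_eq_weyl, hv, hτ] at h
    have hχ0 : χ a ≠ 0 := weyl_eigenvalue_ne_zero (e := exponents (g a)) hψ (hχ a)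
    refine weyl_mulVec_injective e ?_
    rw [hWv]
    exact (smul_right_injective _ hχ0 h).symm
  exact ⟨c, by rw [← hWv, hc, mulVec_smul]⟩

/-- Since the columns are multiples of `w`, projecting onto `w` from the left does not change `M`;
by Hermiticity the same holds from the right. Only a multiple of the projection survives, and the
trace identifies the scalar. -/
theorem eq_trace_smul_vecMulVec {I : Type*} [Fintype I] {M : Matrix I I ℂ} (hM : Mᴴ = M)
    {w : I → ℂ} (hw : star w ⬝ᵥ w = 1) (hcol : ∀ y, ∃ c : ℂ, (fun x => M x y) = c • w) :
    M = M.trace • vecMulVec w (star w) := by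
  choose r hr using hcol
  have h1 : M = vecMulVec w r := by
    ext x y
    rw [vecMulVec_apply, mul_comm]
    exact congrFun (hr y) x
  have h2 : vecMulVec w (star w) * M = M := by
    rw [h1, vecMulVec_mul_vecMulVec, hw, one_smul]
  have h3 : M * vecMulVec w (star w) = M := by
    have := congrArg conjTranspose h2
    rwa [conjTranspose_mul, conjTranspose_vecMulVec, star_star, hM] at this
  have h4 : M = (r ⬝ᵥ w) • vecMulVec w (star w) := by
    conv_lhs => rw [← h3, h1, vecMulVec_mul_vecMulVec]
    ext x y; simp [vecMulVec_apply]; ring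
  have h5 : M.trace = r ⬝ᵥ w := by
    rw [h4, trace_smul, trace_vecMulVec, dotProduct_comm w, hw, smul_eq_mul, mul_one]
  rw [h5]; exact h4

/-- A Hermitian operator supported in a joint eigenspace of a complete stabilizer is a multiple of
a pure state that is a Weyl translate of the stabilized state. -/
theorem exists_weyl_eq_trace_smul {g : Fin k → P → PureExponent d} {φ : (P → Fin d) → ℂ}
    (hφ : star φ ⬝ᵥ φ = 1) (hfix : ∀ a, pauliOp (g a) *ᵥ φ = φ)
    (hline : ∀ v, (∀ a, pauliOp (g a) *ᵥ v = v) → ∃ c : ℂ, v = c • φ)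
    {M : Matrix (P → Fin d) (P → Fin d) ℂ} (hM : Mᴴ = M) {χ : Fin k → ℂ}
    (hχ : ∀ a, pauliOp (g a) * M = χ a • M) :
    ∃ e : P → ℕ × ℕ,
      M = M.trace • vecMulVec (weyl d e *ᵥ φ) (star (weyl d e *ᵥ φ)) := by
  by_cases hM0 : M = 0
  · exact ⟨0, by simp [hM0]⟩
  have hφ0 : φ ≠ 0 := by rintro rfl; simp at hφ
  have hcol : ∀ y a, pauliOp (g a) *ᵥ (fun x => M x y) = χ a • fun x => M x y := fun y a => by
    ext x
    exact congrFun (congrFun (hχ a) x) y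
  obtain ⟨y, hy⟩ : ∃ y, (fun x => M x y) ≠ 0 := by
    by_contra! h
    exact hM0 (by ext x y; exact congrFun (h y) x)
  obtain ⟨e, he⟩ := exists_weyl_of_eigenvector hφ0 hfix hline hy (hcol y)
  refine ⟨e, eq_trace_smul_vecMulVec hM ?_ fun y => he _ (hcol y)⟩
  rw [star_weyl_dotProduct_weyl, hφ]

end Stabilized

/-! ### Product vectors stabilized up to phases -/

section ProductVectors

variable {d : ℕ} [NeZero d] {P : Type} [Fintype P] [DecidableEq P] {k : ℕ}

theorem weyl_mulVec_mul (q : P → Prop) [DecidablePred q] (e : P → ℕ × ℕ)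
    (u : ({p // q p} → Fin d) → ℂ) (v : ({p // ¬ q p} → Fin d) → ℂ) :
    weyl d e *ᵥ (fun y => u (fun p => y p) * v (fun p => y p)) =
      fun x => (weyl d (fun p : {p // q p} => e p) *ᵥ u) (fun p => x p) *
        (weyl d (fun p : {p // ¬ q p} => e p) *ᵥ v) (fun p => x p) :=
  tensor_mulVec_mul q (fun p => weylFactor d (e p)) u v

/-- A joint eigenvector that is a product across a bipartition forces local commutation. -/
theorem prod_twist_eq_one_of_product_eigenvector (q : P → Prop) [DecidablePred q]
    {e f : P → ℕ × ℕ} {ψ : (P → Fin d) → ℂ} (hψ : ψ ≠ 0) {u : ({p // q p} → Fin d) → ℂ}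
    {v : ({p // ¬ q p} → Fin d) → ℂ} (huv : ∀ x, ψ x = u (fun p => x p) * v (fun p => x p))
    {a b : ℂ} (he : weyl d e *ᵥ ψ = a • ψ) (hf : weyl d f *ᵥ ψ = b • ψ) :
    ∏ p : {p // q p}, twist d (e p) (f p) = 1 := by
  obtain ⟨z, hz⟩ := Function.ne_iff.1 hψ
  have hu : u (fun p => z p) ≠ 0 := fun h => hz (by rw [huv, h, zero_mul]; rfl)
  have hv : v (fun p => z p) ≠ 0 := fun h => hz (by rw [huv, h, mul_zero]; rfl)
  -- Freezing the coordinates outside `q` at those of `z`, where `ψ` is nonzero, turns the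
  -- eigenvalue equation of `ψ` into one for `u`.
  have key : ∀ (e : P → ℕ × ℕ) (a : ℂ), weyl d e *ᵥ ψ = a • ψ →
      ∃ c : ℂ, weyl d (fun p : {p // q p} => e p) *ᵥ u = c • u := by
    intro e a h
    have ha := weyl_eigenvalue_ne_zero hψ h
    have hψ' : ψ = fun y => u (fun p => y p) * v (fun p => y p) := funext huv
    rw [hψ', weyl_mulVec_mul] at h
    set u' := weyl d (fun p : {p // q p} => e p) *ᵥ u
    set v' := weyl d (fun p : {p // ¬ q p} => e p) *ᵥ v
    have hx : ∀ x, u' x * v' (fun p => z p) = a * (u x * v (fun p => z p)) := fun x => by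
      let w : P → Fin d := fun p => if hp : q p then x ⟨p, hp⟩ else z p
      have h1 : (fun p : {p // q p} => w p) = x := by ext ⟨p, hp⟩; simp [w, hp]
      have h2 : (fun p : {p // ¬ q p} => w p) = fun p : {p // ¬ q p} => z p := by ext ⟨p, hp⟩; simp [w, hp]
      have := congrFun h w
      simpa [h1, h2] using this
    have hv' : v' (fun p => z p) ≠ 0 := by
      intro h0
      have := hx (fun p => z p)
      rw [h0, mul_zero] at this
      exact mul_ne_zero ha (mul_ne_zero hu hv) this.symm
    refine ⟨a * v (fun p => z p) / v' (fun p => z p), ?_⟩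
    ext x
    rw [Pi.smul_apply, smul_eq_mul, div_mul_eq_mul_div, eq_div_iff hv', hx]
    ring
  obtain ⟨c, hc⟩ := key e a he
  obtain ⟨c', hc'⟩ := key f b hf
  have hu0 : u ≠ 0 := fun h => hu (by rw [h]; rfl)
  exact prod_twist_eq_one_of_eigenvector hu0 hc hc'

/-- The partition into a set and its complement. -/
def bipartition (A : Finset P) (hA : A.Nonempty) (hA' : A ≠ Finset.univ) :
    Finpartition (Finset.univ : Finset P) :=
  (Finpartition.indiscrete hA.ne_empty).extend (b := Aᶜ) (c := Finset.univ)
    (by simpa using hA') disjoint_compl_right (by simp)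

theorem mem_bipartition_parts {A : Finset P} {hA : A.Nonempty} {hA' : A ≠ Finset.univ}
    {U : Finset P} : U ∈ (bipartition A hA hA').parts ↔ U = Aᶜ ∨ U = A := by
  simp [bipartition]

theorem commuteLocally_iff (g : Fin k → P → PureExponent d)
    (Q : Finpartition (Finset.univ : Finset P)) :
    CommuteLocally g Q ↔ ∀ T ∈ Q.parts, ∀ a b,
      ∏ p ∈ T, twist d (exponents (g a) p) (exponents (g b) p) = 1 := by
  simp only [CommuteLocally, commute_pauliOp_restrict_iff]

/-- A factorization across `A` would make the generators commute on `A`. The joint eigenvector makes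
them commute globally, hence on `Aᶜ` as well, and `{A, Aᶜ}` would contradict inseparability. -/
theorem isGenuinelyEntangled_of_eigenvector {g : Fin k → P → PureExponent d}
    (hg : IsInseparable g) {ψ : (P → Fin d) → ℂ} (hψ : ψ ≠ 0)
    (h : ∀ a, ∃ c : ℂ, pauliOp (g a) *ᵥ ψ = c • ψ) : IsGenuinelyEntangled ψ := by
  rintro A hA hA' ⟨u, v, huv⟩
  simp only [pauliOp_eq_weyl] at h
  choose c hc using h
  have hone : ∀ a b, ∏ p ∈ A, twist d (exponents (g a) p) (exponents (g b) p) = 1 := fun a b => by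
    rw [Finset.prod_subtype A (p := (· ∈ A)) fun _ => Iff.rfl]
    exact prod_twist_eq_one_of_product_eigenvector (· ∈ A) hψ huv (hc a) (hc b)
  have hall : ∀ a b, ∏ p, twist d (exponents (g a) p) (exponents (g b) p) = 1 := fun a b =>
    prod_twist_eq_one_of_eigenvector hψ (hc a) (hc b)
  refine hg ⟨bipartition A hA hA', ?_, ?_⟩
  · rw [mem_bipartition_parts]
    rintro (h | h)
    · exact hA.ne_empty (by rw [← compl_compl A, ← h, Finset.compl_univ])
    · exact hA' h.symm
  · rw [commuteLocally_iff]
    intro T hT a b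
    rcases mem_bipartition_parts.1 hT with rfl | rfl
    · have := Finset.prod_mul_prod_compl A
        fun p => twist d (exponents (g a) p) (exponents (g b) p)
      rwa [hone, hall, one_mul] at this
    · exact hone a b

end ProductVectors

/-! ### Separability across a bipartition -/

section Bipartite

variable {P : Type} (q : P → Prop)

/-- Product vectors across the bipartition of the parties given by `q`. -/
def IsProductAcross {H : P → Type} (ψ : (∀ p, H p) → ℂ) : Prop :=
  ∃ (u : (∀ p : {p // q p}, H p) → ℂ) (v : (∀ p : {p // ¬ q p}, H p) → ℂ),
    ∀ x, ψ x = u (fun p => x p) * v (fun p => x p)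

/-- The cone of the (unnormalized) states that are separable across the bipartition of the parties
given by `q`. -/
def productCone (H : P → Type) : AddSubmonoid (Matrix (∀ p, H p) (∀ p, H p) ℂ) :=
  AddSubmonoid.closure {M | ∃ ψ, IsProductAcross q ψ ∧ M = vecMulVec ψ (star ψ)}

variable {q} [Fintype P] [DecidableEq P]

theorem mul_vecMulVec_mul_conjTranspose {I J : Type*} [Fintype J] (K : Matrix I J ℂ) (ψ : J → ℂ) :
    K * vecMulVec ψ (star ψ) * Kᴴ = vecMulVec (K *ᵥ ψ) (star (K *ᵥ ψ)) := by
  rw [mul_vecMulVec, vecMulVec_mul, star_mulVec]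

theorem tensor_conj_mem_productCone [DecidablePred q] {A E : P → Type} [∀ p, Fintype (A p)]
    (K : ∀ p, Matrix (E p) (A p) ℂ)
    {ρ : Matrix (∀ p, A p) (∀ p, A p) ℂ} (hρ : ρ ∈ productCone q A) :
    tensor K * ρ * (tensor K)ᴴ ∈ productCone q E := by
  induction hρ using AddSubmonoid.closure_induction with
  | mem M hM =>
    obtain ⟨ψ, ⟨u, v, huv⟩, rfl⟩ := hM
    refine AddSubmonoid.subset_closure ⟨tensor K *ᵥ ψ, ?_, mul_vecMulVec_mul_conjTranspose _ _⟩
    rw [show ψ = _ from funext huv, tensor_mulVec_mul q K u v]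
    exact ⟨_, _, fun x => rfl⟩
  | zero => simp
  | add M N _ _ hM hN => rw [Matrix.mul_add, Matrix.add_mul]; exact add_mem hM hN

theorem IsLOCC.mem_productCone [DecidablePred q] {A B : P → Type} [∀ p, Fintype (B p)]
    [∀ p, DecidableEq (B p)] [∀ p, Fintype (A p)] [∀ p, DecidableEq (A p)]
    {Λ : Matrix (∀ p, A p) (∀ p, A p) ℂ → Matrix (∀ p, B p) (∀ p, B p) ℂ} (hΛ : IsLOCC A Λ)
    {ρ : Matrix (∀ p, A p) (∀ p, A p) ℂ} (hρ : ρ ∈ productCone q A) : Λ ρ ∈ productCone q B := by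
  induction hΛ with
  | done => exact hρ
  | round A E r K hK Λ hΛ ih =>
    exact sum_mem fun o _ => ih o (tensor_conj_mem_productCone _ hρ)

/-- Summing over all outcomes loses no probability; this normalizes the fidelity bound, and later
the distilled state. -/
theorem IsLOCC.trace_eq {A B : P → Type} [∀ p, Fintype (B p)]
    [∀ p, DecidableEq (B p)] [∀ p, Fintype (A p)] [∀ p, DecidableEq (A p)]
    {Λ : Matrix (∀ p, A p) (∀ p, A p) ℂ → Matrix (∀ p, B p) (∀ p, B p) ℂ} (hΛ : IsLOCC A Λ)
    (ρ : Matrix (∀ p, A p) (∀ p, A p) ℂ) : (Λ ρ).trace = ρ.trace := by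
  induction hΛ with
  | done => rfl
  | round A E r K hK Λ hΛ ih =>
    have h : ∑ o : ∀ p, Fin (r p), (tensor fun p => K p (o p))ᴴ * tensor (fun p => K p (o p)) =
        1 := by
      simp only [tensor_conjTranspose, tensor_mul]
      rw [sum_tensor fun p o => (K p o)ᴴ * K p o]
      simp only [hK, tensor_one]
    simp only [trace_sum, ih]
    conv_rhs => rw [← one_mul ρ, ← h, Finset.sum_mul, trace_sum]
    refine Finset.sum_congr rfl fun o _ => ?_
    rw [Matrix.trace_mul_comm, ← Matrix.mul_assoc]

theorem trace_copies {H : P → Type} [∀ p, Fintype (H p)] (N : ℕ)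
    (ρ : Matrix (∀ p, H p) (∀ p, H p) ℂ) : (copies N ρ).trace = ρ.trace ^ N := by
  have h : ρ.trace ^ N = ∏ _c : Fin N, ∑ x : ∀ p, H p, ρ x x := by
    rw [Finset.prod_const, Finset.card_univ, Fintype.card_fin]; rfl
  rw [h, Fintype.prod_sum]
  exact Fintype.sum_equiv (Equiv.piComm fun p (_ : Fin N) => H p) _ _ fun x => rfl

/-- Expanding the copies gives one term for each choice of a summand in every copy, and a tensor
power of product vectors is again a product across the cut. -/
theorem copies_mem_productCone {H : P → Type} {κ : Type*} [Fintype κ] (N : ℕ)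
    (ψ : κ → (∀ p, H p) → ℂ) (hψ : ∀ s, IsProductAcross q (ψ s)) :
    copies N (∑ s, vecMulVec (ψ s) (star (ψ s))) ∈ productCone q fun p => Fin N → H p := by
  choose u v huv using hψ
  have h : copies N (∑ s, vecMulVec (ψ s) (star (ψ s))) =
      ∑ f : Fin N → κ, vecMulVec (fun x : ∀ p, Fin N → H p => ∏ c, ψ (f c) fun p => x p c)
        (star fun x : ∀ p, Fin N → H p => ∏ c, ψ (f c) fun p => x p c) := by
    ext x y
    simp only [copies, of_apply, Matrix.sum_apply, vecMulVec_apply, Fintype.prod_sum,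
      Finset.prod_mul_distrib, Pi.star_apply, star_prod]
  rw [h]
  refine sum_mem fun f _ => AddSubmonoid.subset_closure ⟨_, ?_, rfl⟩
  refine ⟨fun x => ∏ c, u (f c) fun p => x p c, fun x => ∏ c, v (f c) fun p => x p c, fun x => ?_⟩
  simp only [huv, Finset.prod_mul_distrib]

/-- The coordinates of two different parties and those of the others. -/
def splitPair (H : P → Type) {i j : P} (hij : i ≠ j) :
    (∀ p, H p) ≃ (∀ p : {p // p ≠ i ∧ p ≠ j}, H p) × (H i × H j) where
  toFun x := (fun p => x p, (x i, x j))
  invFun w p := if h : p = i then h.symm ▸ w.2.1 else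
    if h' : p = j then h'.symm ▸ w.2.2 else w.1 ⟨p, h, h'⟩
  left_inv x := by
    funext p
    by_cases h : p = i
    · subst h; simp
    · by_cases h' : p = j
      · subst h'; simp [h]
      · simp [h, h']
  right_inv w := by
    obtain ⟨z, a, b⟩ := w
    refine Prod.ext ?_ (Prod.ext ?_ ?_)
    · funext ⟨p, h, h'⟩; simp [h, h']
    · simp
    · simp [hij.symm]

/-- The partial trace becomes a sum over the configurations `z` of the other parties. -/
theorem pairFidelity_eq {H : P → Type} [∀ p, Fintype (H p)] [∀ p, DecidableEq (H p)] {i j : P}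
    (hij : i ≠ j) (φ : H i → H j → ℂ) (σ : Matrix (∀ p, H p) (∀ p, H p) ℂ) :
    pairFidelity i j φ σ = (∑ z, ∑ w : H i × H j, ∑ w' : H i × H j, star (φ w.1 w.2) *
      σ ((splitPair H hij).symm (z, w)) ((splitPair H hij).symm (z, w')) * φ w'.1 w'.2).re := by
  rw [pairFidelity]
  congr 1
  rw [← (splitPair H hij).symm.sum_comp, Fintype.sum_prod_type]
  refine Finset.sum_congr rfl fun z _ => Finset.sum_congr rfl fun w _ => ?_
  rw [← (splitPair H hij).symm.sum_comp, Fintype.sum_prod_type, Finset.sum_eq_single z]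
  · refine Finset.sum_congr rfl fun w' _ => ?_
    rw [if_pos]
    · simp [splitPair, hij.symm]
    · intro p h h'; simp [splitPair, h, h']
  · intro z' _ hz'
    refine Finset.sum_eq_zero fun w' _ => if_neg fun h => hz' ?_
    funext ⟨p, hp, hp'⟩
    have := h p hp hp'
    simpa [splitPair, hp, hp'] using this.symm
  · simp

/-- The overlap of `φ` with unit product vectors attains its maximum on a product of two spheres.
Equality in Cauchy–Schwarz would make `φ` a product, so the maximum is below 1, and scaling extends
the bound to all product vectors. -/
theorem exists_overlap_bound {I J : Type*} [Fintype I] [Fintype J] (φ : I → J → ℂ)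
    (hφ : ∑ a, ∑ b, ‖φ a b‖ ^ 2 = 1)
    (hent : ¬ ∃ (u : I → ℂ) (v : J → ℂ), ∀ a b, φ a b = u a * v b) :
    ∃ μ : ℝ, μ < 1 ∧ ∀ (u : I → ℂ) (v : J → ℂ),
      ‖∑ w : I × J, star (φ w.1 w.2) * (u w.1 * v w.2)‖ ^ 2 ≤
        μ * ∑ w : I × J, ‖u w.1 * v w.2‖ ^ 2 := by
  let Φ : EuclideanSpace ℂ (I × J) := WithLp.toLp 2 fun w => φ w.1 w.2
  let E : EuclideanSpace ℂ I × EuclideanSpace ℂ J → EuclideanSpace ℂ (I × J) :=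
    fun s => WithLp.toLp 2 fun w => s.1 w.1 * s.2 w.2
  have hE : Continuous E := by
    refine (PiLp.continuous_toLp 2 _).comp (continuous_pi fun w => ?_)
    fun_prop
  have hEnorm : ∀ s, ‖E s‖ = ‖s.1‖ * ‖s.2‖ := fun s => by
    rw [← sq_eq_sq₀ (norm_nonneg _) (by positivity), mul_pow, EuclideanSpace.norm_sq_eq,
      EuclideanSpace.norm_sq_eq, EuclideanSpace.norm_sq_eq, Fintype.sum_mul_sum,
      Fintype.sum_prod_type]
    simp [E, mul_pow]
  have hΦ : ‖Φ‖ = 1 := by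
    rw [← sq_eq_sq₀ (norm_nonneg _) zero_le_one, EuclideanSpace.norm_sq_eq, Fintype.sum_prod_type,
      one_pow]
    exact hφ
  have hΦ0 : Φ ≠ 0 := by rw [← norm_ne_zero_iff, hΦ]; exact one_ne_zero
  have hinner : ∀ s, inner ℂ Φ (E s) = ∑ w : I × J, star (φ w.1 w.2) * (s.1 w.1 * s.2 w.2) :=
    fun s => by
      simp [PiLp.inner_apply, Φ, E, mul_comm]
  have hlt : ∀ s, ‖s.1‖ = 1 → ‖s.2‖ = 1 → ‖(inner ℂ Φ (E s) : ℂ)‖ < 1 := by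
    intro s h1 h2
    have hEs : ‖E s‖ = 1 := by rw [hEnorm, h1, h2, one_mul]
    have hle := norm_inner_le_norm (𝕜 := ℂ) Φ (E s)
    rw [hΦ, hEs, one_mul] at hle
    refine lt_of_le_of_ne hle fun heq => hent ?_
    have hE0 : E s ≠ 0 := by rw [← norm_ne_zero_iff, hEs]; exact one_ne_zero
    obtain ⟨r, -, hr⟩ := (norm_inner_eq_norm_iff (𝕜 := ℂ) hE0 hΦ0).1
      (by rw [norm_inner_symm, heq, hΦ, hEs, one_mul])
    refine ⟨fun a => r * s.1 a, fun b => s.2 b, fun a b => ?_⟩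
    have := congrArg (fun v : EuclideanSpace ℂ (I × J) => v (a, b)) hr
    simpa [Φ, E, mul_assoc] using this
  have hne : Nonempty (I × J) := by
    by_contra h
    rw [not_nonempty_iff] at h
    rw [← Fintype.sum_prod_type'] at hφ
    simp at hφ
  have hI : Nonempty I := hne.map Prod.fst
  have hJ : Nonempty J := hne.map Prod.snd
  obtain ⟨s, hs, hmax⟩ := ((isCompact_sphere (0 : EuclideanSpace ℂ I) 1).prod
    (isCompact_sphere (0 : EuclideanSpace ℂ J) 1)).exists_isMaxOn
    ((NormedSpace.sphere_nonempty.2 zero_le_one).prod (NormedSpace.sphere_nonempty.2 zero_le_one))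
    (f := fun s => ‖(inner ℂ Φ (E s) : ℂ)‖) (by fun_prop)
  have hs1 : ‖s.1‖ = 1 := by simpa using hs.1
  have hs2 : ‖s.2‖ = 1 := by simpa using hs.2
  refine ⟨‖(inner ℂ Φ (E s) : ℂ)‖ ^ 2, pow_lt_one₀ (norm_nonneg _) (hlt s hs1 hs2) two_ne_zero,
    fun u v => ?_⟩
  have hle : ∀ s', ‖(inner ℂ Φ (E s') : ℂ)‖ ≤ ‖(inner ℂ Φ (E s) : ℂ)‖ * (‖s'.1‖ * ‖s'.2‖) := by
    intro s'
    by_cases h1 : ‖s'.1‖ = 0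
    · have : E s' = 0 := by rw [← norm_eq_zero, hEnorm, h1, zero_mul]
      simp [this, h1]
    by_cases h2 : ‖s'.2‖ = 0
    · have : E s' = 0 := by rw [← norm_eq_zero, hEnorm, h2, mul_zero]
      simp [this, h2]
    have h1' : ((‖s'.1‖ : ℝ) : ℂ) ≠ 0 := Complex.ofReal_ne_zero.2 h1
    have h2' : ((‖s'.2‖ : ℝ) : ℂ) ≠ 0 := Complex.ofReal_ne_zero.2 h2
    have hscale : E s' = ((‖s'.1‖ * ‖s'.2‖ : ℝ) : ℂ) •
        E ((‖s'.1‖ : ℂ)⁻¹ • s'.1, (‖s'.2‖ : ℂ)⁻¹ • s'.2) := by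
      ext w
      simp only [E, PiLp.smul_apply, smul_eq_mul]
      push_cast
      field_simp
    have hm : ‖(inner ℂ Φ (E ((‖s'.1‖ : ℂ)⁻¹ • s'.1, (‖s'.2‖ : ℂ)⁻¹ • s'.2)) : ℂ)‖ ≤
        ‖(inner ℂ Φ (E s) : ℂ)‖ :=
      hmax (a := ((‖s'.1‖ : ℂ)⁻¹ • s'.1, (‖s'.2‖ : ℂ)⁻¹ • s'.2))
        ⟨by simp [norm_smul, h1], by simp [norm_smul, h2]⟩
    rw [hscale, inner_smul_right, norm_mul, Complex.norm_real, Real.norm_of_nonneg (by positivity),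
      mul_comm]
    exact mul_le_mul_of_nonneg_right hm (by positivity)
  have h := hle (WithLp.toLp 2 u, WithLp.toLp 2 v)
  rw [← hEnorm, hinner] at h
  have h2 := pow_le_pow_left₀ (norm_nonneg _) h 2
  rw [mul_pow, EuclideanSpace.norm_sq_eq] at h2
  exact h2

/-- Fidelity and trace are additive, so generators of the cone suffice, and for these the overlap
bound is summed over the configurations of the other parties. -/
theorem exists_pairFidelity_bound {H : P → Type} [∀ p, Fintype (H p)] [∀ p, DecidableEq (H p)]
    {i j : P} (hij : i ≠ j) (hi : q i) (hj : ¬ q j) (φ : H i → H j → ℂ)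
    (hφ : ∑ a, ∑ b, ‖φ a b‖ ^ 2 = 1)
    (hent : ¬ ∃ (u : H i → ℂ) (v : H j → ℂ), ∀ a b, φ a b = u a * v b) :
    ∃ μ : ℝ, μ < 1 ∧ ∀ σ ∈ productCone q H, pairFidelity i j φ σ ≤ μ * σ.trace.re := by
  obtain ⟨μ, hμ, hbound⟩ := exists_overlap_bound φ hφ hent
  refine ⟨μ, hμ, fun σ hσ => ?_⟩
  induction hσ using AddSubmonoid.closure_induction with
  | zero => simp [pairFidelity]
  | add M N _ _ hM hN =>
    rw [pairFidelity_eq hij] at hM hN ⊢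
    rw [trace_add, Complex.add_re, mul_add]
    simp only [Matrix.add_apply, mul_add, add_mul, Finset.sum_add_distrib, Complex.add_re]
    exact add_le_add hM hN
  | mem M hM =>
    obtain ⟨ψ, ⟨u, v, huv⟩, rfl⟩ := hM
    -- As `i` and `j` lie on opposite sides, fixing all other coordinates leaves `u` a function of
    -- `i` alone and `v` of `j` alone.
    have hprod : ∀ z, ∃ (U : H i → ℂ) (V : H j → ℂ), ∀ w : H i × H j,
        ψ ((splitPair H hij).symm (z, w)) = U w.1 * V w.2 := by
      intro z
      refine ⟨fun a => u fun p => if h : p.1 = i then h.symm ▸ a else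
          z ⟨p, h, fun h' => hj (h' ▸ p.2)⟩,
        fun b => v fun p => if h : p.1 = j then h.symm ▸ b else
          z ⟨p, fun h' => p.2 (h'.symm ▸ hi), h⟩, fun w => ?_⟩
      rw [huv]
      congr 2
      · funext ⟨p, hp⟩
        have hpj : p ≠ j := fun h' => hj (h' ▸ hp)
        simp [splitPair, hpj]
      · funext ⟨p, hp⟩
        have hpi : p ≠ i := fun h' => hp (h'.symm ▸ hi)
        simp [splitPair, hpi]
    have hF : pairFidelity i j φ (vecMulVec ψ (star ψ)) = ∑ z, ‖∑ w : H i × H j,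
        star (φ w.1 w.2) * ψ ((splitPair H hij).symm (z, w))‖ ^ 2 := by
      rw [pairFidelity_eq hij, Complex.re_sum]
      refine Finset.sum_congr rfl fun z _ => ?_
      have : ∑ w : H i × H j, ∑ w' : H i × H j, star (φ w.1 w.2) *
          vecMulVec ψ (star ψ) ((splitPair H hij).symm (z, w)) ((splitPair H hij).symm (z, w')) *
            φ w'.1 w'.2 =
          (∑ w : H i × H j, star (φ w.1 w.2) * ψ ((splitPair H hij).symm (z, w))) *
          star (∑ w : H i × H j, star (φ w.1 w.2) * ψ ((splitPair H hij).symm (z, w))) := by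
        rw [star_sum, Fintype.sum_mul_sum]
        refine Finset.sum_congr rfl fun w _ => Finset.sum_congr rfl fun w' _ => ?_
        simp only [vecMulVec_apply, Pi.star_apply, star_mul', star_star]
        ring
      rw [this]
      have h2 := Complex.mul_conj' (∑ w : H i × H j,
        star (φ w.1 w.2) * ψ ((splitPair H hij).symm (z, w)))
      rw [← Complex.ofReal_pow] at h2
      exact (congrArg Complex.re h2).trans (Complex.ofReal_re _)
    have hT : (vecMulVec ψ (star ψ)).trace.re = ∑ z, ∑ w : H i × H j,
        ‖ψ ((splitPair H hij).symm (z, w))‖ ^ 2 := by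
      rw [← Fintype.sum_prod_type', (splitPair H hij).symm.sum_comp fun x => ‖ψ x‖ ^ 2, trace,
        Complex.re_sum]
      refine Finset.sum_congr rfl fun x _ => ?_
      have h2 := Complex.mul_conj' (ψ x)
      rw [← Complex.ofReal_pow] at h2
      exact (congrArg Complex.re h2).trans (Complex.ofReal_re _)
    rw [hF, hT, Finset.mul_sum]
    refine Finset.sum_le_sum fun z _ => ?_
    obtain ⟨U, V, hUV⟩ := hprod z
    simp only [hUV]
    exact hbound U V

/-- A state that is a mixture of product vectors across a bipartition is not distillable between
parties on different sides. -/
theorem not_isDistillable_of_sum [DecidablePred q] {H : P → Type} [∀ p, Fintype (H p)]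
    [∀ p, DecidableEq (H p)] {κ : Type*} [Fintype κ] (ψ : κ → (∀ p, H p) → ℂ)
    (hψ : ∀ s, IsProductAcross q (ψ s)) {ρ : Matrix (∀ p, H p) (∀ p, H p) ℂ} (htr : ρ.trace = 1)
    (hρ : ρ = ∑ s, vecMulVec (ψ s) (star (ψ s))) {i j : P} (hi : q i) (hj : ¬ q j) :
    ¬ IsDistillable ρ i j := by
  have hij : i ≠ j := fun h => hj (h ▸ hi)
  rintro ⟨B, φ, hφ, hent, hdist⟩
  obtain ⟨μ, hμ, hbound⟩ := exists_pairFidelity_bound (H := fun p => Fin (B p)) hij hi hj φ hφ hent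
  obtain ⟨N, Λ, hΛ, hF⟩ := hdist ((1 - μ) / 2) (by linarith)
  have hmem : Λ (copies N ρ) ∈ productCone q fun p => Fin (B p) :=
    hΛ.mem_productCone (hρ ▸ copies_mem_productCone N ψ hψ)
  have h := hbound _ hmem
  rw [hΛ.trace_eq, trace_copies, htr, one_pow, Complex.one_re] at h
  linarith

end Bipartite

/-! ### Stabilizer states across a cut -/

section Stabilizer

variable {d : ℕ} [NeZero d] {P : Type} [Fintype P] [DecidableEq P] {k : ℕ}

/-- A stabilizer state is a mixture of product vectors across each bipartition with respect to
which the generators commute locally. -/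
theorem exists_stabilizerState_eq_sum (q : P → Prop) [DecidablePred q]
    (g : Fin k → P → PureExponent d)
    (hq : ∀ a b, ∏ p with q p, twist d (exponents (g a) p) (exponents (g b) p) = 1)
    (hq' : ∀ a b, ∏ p with ¬ q p, twist d (exponents (g a) p) (exponents (g b) p) = 1) :
    ∃ (κ : Type) (_ : Fintype κ) (ψ : κ → (P → Fin d) → ℂ),
      (∀ s, IsProductAcross q (ψ s)) ∧
        stabilizerState g = ∑ s, vecMulVec (ψ s) (star (ψ s)) := by
  obtain ⟨b, hb⟩ := exists_orthonormalBasis_pauliOp (fun a (p : {p // q p}) => g a p)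
    fun a b => (commute_pauliOp_iff _ _).2 <| by
      rw [← hq a b, Finset.prod_subtype (p := q) _ (by simp)]; rfl
  obtain ⟨c, hc⟩ := exists_orthonormalBasis_pauliOp (fun a (p : {p // ¬ q p}) => g a p)
    fun a b => (commute_pauliOp_iff _ _).2 <| by
      rw [← hq' a b, Finset.prod_subtype (p := fun p => ¬ q p) _ (by simp)]; rfl
  let v : ({p // q p} → Fin d) × ({p // ¬ q p} → Fin d) → (P → Fin d) → ℂ :=
    fun s x => (b s.1).ofLp (fun p => x p) * (c s.2).ofLp (fun p => x p)
  -- The products of the two local eigenbases resolve the identity.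
  have hsum : ∑ s, vecMulVec (v s) (star (v s)) = 1 := by
    ext x y
    have h1 := congrFun (congrFun (sum_vecMulVec_orthonormalBasis b) fun p => x p) fun p => y p
    have h2 := congrFun (congrFun (sum_vecMulVec_orthonormalBasis c) fun p => x p) fun p => y p
    rw [Matrix.sum_apply] at h1 h2
    have h3 : ∑ s, vecMulVec (v s) (star (v s)) x y =
        (∑ i, vecMulVec (b i).ofLp (star (b i).ofLp) (fun p => x p) fun p => y p) *
        (∑ i, vecMulVec (c i).ofLp (star (c i).ofLp) (fun p => x p) fun p => y p) := by
      rw [Fintype.sum_mul_sum, Fintype.sum_prod_type]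
      refine Finset.sum_congr rfl fun i _ => Finset.sum_congr rfl fun j _ => ?_
      simp only [vecMulVec_apply, v, Pi.star_apply, star_mul']
      ring
    rw [Matrix.sum_apply, h3, h1, h2]
    by_cases hxy : x = y
    · subst hxy; rw [one_apply_eq, one_apply_eq, one_apply_eq, mul_one]
    · rw [one_apply_ne hxy]
      obtain ⟨p, hp⟩ := Function.ne_iff.1 hxy
      by_cases hqp : q p
      · rw [one_apply_ne fun h => hp (congrFun h ⟨p, hqp⟩), zero_mul]
      · rw [one_apply_ne (fun h => hp (congrFun h ⟨p, hqp⟩) : (fun p : {p // ¬ q p} => x p) ≠ _),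
          mul_zero]
  have heig : ∀ s a, ∃ e : ℂ, pauliOp (g a) *ᵥ v s = e • v s := by
    intro s a
    obtain ⟨e, he⟩ := hb s.1 a
    obtain ⟨f, hf⟩ := hc s.2 a
    rw [pauliOp_eq_weyl] at he hf ⊢
    refine ⟨e * f, ?_⟩
    have h := weyl_mulVec_mul q (exponents (g a)) (b s.1).ofLp (c s.2).ofLp
    refine h.trans ?_
    ext x
    have h1 := congrFun he fun p => x p
    have h2 := congrFun hf fun p => x p
    refine (congrArg₂ (· * ·) h1 h2).trans ?_
    simp only [v, Pi.smul_apply, smul_eq_mul]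
    ring
  -- The projection keeps a joint eigenvector whose eigenvalues are all 1 and kills the others, so
  -- `t` is 0 or 1.
  have hproj : ∀ s, ∃ t : ℂ, t * star t = t ∧ stabilizerProj g *ᵥ v s = t • v s := by
    intro s
    by_cases h : ∀ a, pauliOp (g a) *ᵥ v s = v s
    · exact ⟨1, by simp, by rw [stabilizerProj_mulVec_of_fixed h, one_smul]⟩
    · push Not at h
      obtain ⟨a, ha⟩ := h
      obtain ⟨e, he⟩ := heig s a
      refine ⟨0, by simp, ?_⟩
      rw [zero_smul]
      exact stabilizerProj_mulVec_eq_zero he fun h1 => ha (by rw [he, h1, one_smul])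
  choose t ht htv using hproj
  have htr : 0 ≤ (stabilizerProj g).trace⁻¹ :=
    inv_nonneg.2 (stabilizerProj_posSemidef g).trace_nonneg
  -- The normalization must be absorbed into the vectors, hence a square root of it.
  obtain ⟨r, hr⟩ : ∃ r : ℂ, r * star r = (stabilizerProj g).trace⁻¹ := by
    obtain ⟨hre, him⟩ := Complex.nonneg_iff.1 htr
    refine ⟨(Real.sqrt (stabilizerProj g).trace⁻¹.re : ℝ), ?_⟩
    rw [Complex.star_def, Complex.conj_ofReal, ← Complex.ofReal_mul, Real.mul_self_sqrt hre]
    exact Complex.ext rfl (by simpa using him)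
  refine ⟨_, inferInstance, fun s => (r * t s) • v s, fun s => ⟨fun x => r * t s * (b s.1).ofLp x,
    fun x => (c s.2).ofLp x, fun x => by simp [v, mul_assoc]⟩, ?_⟩
  have hP : stabilizerProj g = ∑ s, t s • vecMulVec (v s) (star (v s)) := by
    conv_lhs => rw [← mul_one (stabilizerProj g), ← hsum, Finset.mul_sum]
    simp only [mul_vecMulVec, htv, smul_vecMulVec]
  rw [stabilizerState_eq]
  nth_rw 2 [hP]
  rw [Finset.smul_sum]
  refine Finset.sum_congr rfl fun s _ => ?_
  rw [star_smul, smul_vecMulVec, vecMulVec_smul, smul_smul, smul_smul, ← hr]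
  congr 1
  rw [star_mul']
  linear_combination -(r * star r) * ht s

theorem not_isDistillable_stabilizerState (A : Finset P) {g : Fin k → P → PureExponent d}
    (hV : stabilized g ≠ ⊥)
    (hcomm : ∀ a b, Commute (pauliOp (g a)) (pauliOp (g b)))
    (hA : ∀ a b, Commute (pauliOp (restrict (g a) A)) (pauliOp (restrict (g b) A)))
    {i j : P} (hi : i ∈ A) (hj : j ∉ A) : ¬ IsDistillable (stabilizerState g) i j := by
  have h1 : ∀ a b, ∏ p ∈ A, twist d (exponents (g a) p) (exponents (g b) p) = 1 :=
    fun a b => (commute_pauliOp_restrict_iff _ _ _).1 (hA a b)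
  have h2 : ∀ a b, ∏ p ∈ Aᶜ, twist d (exponents (g a) p) (exponents (g b) p) = 1 :=
    fun a b => by
      have := (commute_pauliOp_iff _ _).1 (hcomm a b)
      rwa [← Finset.prod_mul_prod_compl A, h1, one_mul] at this
  obtain ⟨κ, _, ψ, hψ, hρ⟩ := exists_stabilizerState_eq_sum (· ∈ A) g
    (fun a b => by rw [← h1 a b]; congr 1; ext p; simp)
    (fun a b => by rw [← h2 a b]; congr 1; ext p; simp)
  exact not_isDistillable_of_sum (q := (· ∈ A)) ψ hψ (isDensity_stabilizerState hV).2 hρ hi hj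

end Stabilizer

/-! ### Entanglement of stabilizer states -/

section Entangled

variable {d : ℕ} [NeZero d] {P : Type} [Fintype P] [DecidableEq P] {k : ℕ}

open scoped MatrixOrder Matrix.Norms.L2Operator in
theorem exists_eq_conjTranspose_mul_self {I : Type*} [Fintype I] [DecidableEq I]
    {A : Matrix I I ℂ} (hA : A.PosSemidef) : ∃ B : Matrix I I ℂ, A = Bᴴ * B :=
  CStarAlgebra.nonneg_iff_eq_star_mul_self.mp hA.nonneg

/-- If a sum of positive operators is fixed by `G`, so is each summand. -/
theorem mul_eq_self_of_sum {I κ : Type*} [Fintype I] [DecidableEq I] [Fintype κ]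
    (G : Matrix I I ℂ) (w : κ → ℝ) (hw : ∀ s, 0 < w s) (B : κ → Matrix I I ℂ)
    (hG : G * ∑ s, (w s : ℂ) • ((B s)ᴴ * B s) = ∑ s, (w s : ℂ) • ((B s)ᴴ * B s)) (s : κ) :
    G * ((B s)ᴴ * B s) = (B s)ᴴ * B s := by
  -- Conjugating by `G - 1` gives a vanishing sum of positive operators, so each trace is zero and
  -- `G - 1` kills each `(B s)ᴴ`.
  have h0 : ∑ s, (w s : ℂ) • ((G - 1) * (B s)ᴴ * ((G - 1) * (B s)ᴴ)ᴴ) = 0 := by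
    have h1 : (G - 1) * (∑ s, (w s : ℂ) • ((B s)ᴴ * B s)) * (G - 1)ᴴ = 0 := by
      rw [sub_mul, hG, one_mul, sub_self, zero_mul]
    rw [← h1, Finset.mul_sum, Finset.sum_mul]
    refine Finset.sum_congr rfl fun s _ => ?_
    rw [mul_smul_comm, smul_mul_assoc, conjTranspose_mul, conjTranspose_conjTranspose]
    simp only [mul_assoc]
  have hpos : ∀ s, 0 ≤ ((w s : ℂ) • ((G - 1) * (B s)ᴴ * ((G - 1) * (B s)ᴴ)ᴴ)).trace := fun s =>
    ((posSemidef_self_mul_conjTranspose _).smul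
      (by exact_mod_cast (hw s).le : (0 : ℂ) ≤ (w s : ℂ))).trace_nonneg
  have htr := congrArg trace h0
  rw [trace_sum, trace_zero, Finset.sum_eq_zero_iff_of_nonneg fun s _ => hpos s] at htr
  have h2 := htr s (Finset.mem_univ s)
  rw [trace_smul, smul_eq_zero, trace_mul_conjTranspose_self_eq_zero_iff] at h2
  have h3 := h2.resolve_left (by exact_mod_cast (hw s).ne')
  have h4 := congrArg (fun M => M * B s) h3
  simp only [sub_mul, one_mul, zero_mul, mul_assoc] at h4
  exact sub_eq_zero.1 h4

/-- Every operator that fixes a separable state fixes some common product vector. -/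
theorem IsSeparableState.exists_product_vector {H : P → Type} [∀ p, Fintype (H p)]
    [∀ p, DecidableEq (H p)] {ρ : Matrix (∀ p, H p) (∀ p, H p) ℂ} (hs : IsSeparableState ρ) :
    ∃ v : ∀ p, H p → ℂ, (fun x : ∀ p, H p => ∏ p, v p (x p)) ≠ 0 ∧
      ∀ G : Matrix (∀ p, H p) (∀ p, H p) ℂ, G * ρ = ρ →
        G *ᵥ (fun x => ∏ p, v p (x p)) = fun x => ∏ p, v p (x p) := by
  obtain ⟨r, w, σ, hw, hsum, hσ, rfl⟩ := hs
  obtain ⟨s⟩ : Nonempty (Fin r) := by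
    by_contra h
    rw [not_nonempty_iff] at h
    simp at hsum
  choose B hB using fun s p => exists_eq_conjTranspose_mul_self (hσ s p).1
  have hten : ∀ s, tensor (σ s) = (tensor (B s))ᴴ * tensor (B s) := fun s => by
    rw [tensor_conjTranspose, tensor_mul]
    exact congrArg tensor (funext (hB s))
  obtain ⟨y, hy⟩ : ∃ y, tensor (σ s) y y ≠ 0 := by
    by_contra! h
    have htr : (tensor (σ s)).trace = 1 := by
      rw [trace_tensor]
      exact Finset.prod_eq_one fun p _ => (hσ s p).2
    have htr0 : (tensor (σ s)).trace = 0 := Finset.sum_eq_zero fun y _ => h y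
    exact zero_ne_one (htr0.symm.trans htr)
  -- A column of a product operator is a product vector. Column `y` is nonzero because of its
  -- diagonal entry, and `G` fixes it because `G` fixes the whole summand.
  refine ⟨fun p x => σ s p x (y p), fun h => hy (congrFun h y), fun G hG => ?_⟩
  simp only [hten] at hG
  have h := mul_eq_self_of_sum G w hw _ hG s
  rw [← hten] at h
  ext x
  exact congrFun (congrFun h x) y

theorem prod_twist_eq_one_of_product_vector {e f : P → ℕ × ℕ} {v : P → Fin d → ℂ}
    (hv : (fun x : P → Fin d => ∏ p, v p (x p)) ≠ 0) {a b : ℂ}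
    (he : weyl d e *ᵥ (fun x => ∏ p, v p (x p)) = a • fun x => ∏ p, v p (x p))
    (hf : weyl d f *ᵥ (fun x => ∏ p, v p (x p)) = b • fun x => ∏ p, v p (x p))
    (q : P → Prop) [DecidablePred q] : ∏ p : {p // q p}, twist d (e p) (f p) = 1 :=
  prod_twist_eq_one_of_product_eigenvector q hv
    (u := fun x => ∏ p', v p'.1 (x p')) (v := fun x => ∏ p', v p'.1 (x p'))
    (fun x => (Fintype.prod_subtype_mul_prod_subtype q fun p => v p (x p)).symm) he hf

/-- A full product vector factors across every cut, in particular the one that isolates the qudit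
`p`. -/
theorem IsSeparableState.twist_eq_one {g : Fin k → P → PureExponent d}
    (hs : IsSeparableState (H := fun _ => Fin d) (stabilizerState g)) (a b : Fin k) (p : P) :
    twist d (exponents (g a) p) (exponents (g b) p) = 1 := by
  obtain ⟨v, hv, hfix⟩ := hs.exists_product_vector
  have heig : ∀ a, weyl d (exponents (g a)) *ᵥ (fun x => ∏ p, v p (x p)) =
      (1 : ℂ) • fun x => ∏ p, v p (x p) := fun a => by
    have h := hfix (weyl d (exponents (g a))) (by
      rw [← pauliOp_eq_weyl, pauliOp_mul_stabilizerState])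
    rw [one_smul, h]
  have h := prod_twist_eq_one_of_product_vector hv (heig a) (heig b) (· = p)
  rw [← h]
  convert (Fintype.prod_subsingleton (fun p' : {p' // p' = p} =>
    twist d (exponents (g a) p') (exponents (g b) p')) ⟨p, rfl⟩).symm

/-- Otherwise the partition into singletons would separate; `1 < Fintype.card P` makes its blocks
proper. -/
theorem IsInseparable.exists_twist_ne_one {g : Fin k → P → PureExponent d} (hg : IsInseparable g)
    (hP : 1 < Fintype.card P) :
    ∃ a b p, twist d (exponents (g a) p) (exponents (g b) p) ≠ 1 := by
  by_contra! h
  refine hg ⟨⊥, fun hmem => ?_, (commuteLocally_iff g ⊥).2 fun T _ a b =>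
    Finset.prod_eq_one fun p _ => h a b p⟩
  rw [Finpartition.mem_bot_iff] at hmem
  obtain ⟨p, -, hp⟩ := hmem
  have := congrArg Finset.card hp
  rw [Finset.card_singleton, Finset.card_univ] at this
  omega

end Entangled

/-! ### Partial measurements -/

section PartialBra

/-- The operator `∑_z |f z⟩⟨β|h z⟩⟨z|`: when `z ↦ (f z, h z)` is a bijection, the bra `⟨β|` on the
second tensor factor. -/
def partialBra {X Y Z : Type*} [DecidableEq X] (f : Z → X) (h : Z → Y) (β : Y → ℂ) :
    Matrix X Z ℂ :=
  Matrix.of fun x z => if f z = x then star (β (h z)) else 0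

theorem sum_partialBra {X Y Z κ : Type*} [DecidableEq X] [Fintype X] [Fintype Y] [DecidableEq Y]
    [DecidableEq Z] [Fintype κ] (f : Z → X) (h : Z → Y)
    (hfh : ∀ z z', f z = f z' → h z = h z' → z = z')
    (c : OrthonormalBasis κ ℂ (EuclideanSpace ℂ Y)) :
    ∑ o, (partialBra f h (c o).ofLp)ᴴ * partialBra f h (c o).ofLp = 1 := by
  ext z z'
  have hc := congrFun (congrFun (sum_vecMulVec_orthonormalBasis c) (h z)) (h z')
  rw [Matrix.sum_apply] at hc ⊢
  by_cases hf : f z = f z'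
  · have h1 : ∀ o, ((partialBra f h (c o).ofLp)ᴴ * partialBra f h (c o).ofLp) z z' =
        vecMulVec (c o).ofLp (star (c o).ofLp) (h z) (h z') := fun o => by
      simp [mul_apply, partialBra, vecMulVec_apply, hf]
    rw [Finset.sum_congr rfl fun o _ => h1 o, hc]
    by_cases hz : z = z'
    · rw [hz, one_apply_eq, one_apply_eq]
    · rw [one_apply_ne hz, one_apply_ne fun hh => hz (hfh z z' hf hh)]
  · rw [one_apply_ne fun hz => hf (by rw [hz])]
    refine Finset.sum_eq_zero fun o _ => ?_
    rw [mul_apply]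
    refine Finset.sum_eq_zero fun x _ => ?_
    by_cases hx : f z = x
    · subst hx
      simp [partialBra, Ne.symm hf]
    · simp [partialBra, hx]

theorem tensor_partialBra {κ : Type} [Fintype κ] {X Y Z : κ → Type}
    [∀ s, DecidableEq (X s)] (f : ∀ s, Z s → X s) (h : ∀ s, Z s → Y s) (β : ∀ s, Y s → ℂ) :
    tensor (fun s => partialBra (f s) (h s) (β s)) =
      partialBra (fun z s => f s (z s)) (fun z s => h s (z s)) fun y => ∏ s, β s (y s) := by
  ext x z
  simp only [tensor_apply, partialBra, of_apply, Finset.prod_ite_zero, star_prod, funext_iff,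
    Finset.mem_univ, forall_true_left]

variable {d : ℕ} [NeZero d] {P : Type} [Fintype P] [DecidableEq P] {k : ℕ}

/-- The identity on the parties in `T` and the bra `⟨β|` on the others. -/
def braOn (T : Finset P) (β : ({p // p ∉ T} → Fin d) → ℂ) :
    Matrix ({p // p ∈ T} → Fin d) (P → Fin d) ℂ :=
  partialBra (fun z p => z p) (fun z (p : {p // p ∉ T}) => z p) β

/-- The Weyl operator factors across `T`; its outer factor acts on the bra as a scalar and only the
factor on `T` remains. -/
theorem braOn_mul_weyl (T : Finset P) {β : ({p // p ∉ T} → Fin d) → ℂ} {e : P → ℕ × ℕ} {c : ℂ}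
    (h : star β ᵥ* weyl d (fun p : {p // p ∉ T} => e p) = c • star β) :
    braOn T β * weyl d e = c • (weyl d (fun p : {p // p ∈ T} => e p) * braOn T β) := by
  ext x z
  have hW : ∀ z', weyl d e z' z = weyl d (fun p : {p // p ∈ T} => e p) (fun p => z' p)
      (fun p => z p) * weyl d (fun p : {p // p ∉ T} => e p) (fun p => z' p) fun p => z p := by
    intro z'
    simp only [weyl, tensor_apply]
    rw [← Finset.prod_mul_prod_compl T, ← Finset.prod_coe_sort T,
      Finset.prod_subtype (p := fun p => p ∉ T) Tᶜ (by simp)]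
  have hR : (weyl d (fun p : {p // p ∈ T} => e p) * braOn T β) x z =
      weyl d (fun p : {p // p ∈ T} => e p) x (fun p => z p) * star (β fun p => z p) := by
    refine mul_apply.trans ((Finset.sum_eq_single
      (fun p : {p // p ∈ T} => z p) ?_ ?_).trans ?_)
    · intro x' _ hx'
      simp [braOn, partialBra, hx'.symm]
    · simp
    · simp [braOn, partialBra]
  have hc := congrFun h fun p => z p
  rw [Matrix.smul_apply, hR, mul_apply]
  let ε := Equiv.piEquivPiSubtypeProd (· ∈ T) fun _ : P => Fin d
  have hε1 : ∀ s, (fun p : {p // p ∈ T} => ε.symm s p) = s.1 := fun s =>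
    congrArg Prod.fst (ε.apply_symm_apply s)
  have hε2 : ∀ s, (fun p : {p // p ∉ T} => ε.symm s p) = s.2 := fun s =>
    congrArg Prod.snd (ε.apply_symm_apply s)
  rw [← ε.symm.sum_comp, Fintype.sum_prod_type, Finset.sum_eq_single x]
  · have h3 : ∀ w, braOn T β x (ε.symm (x, w)) * weyl d e (ε.symm (x, w)) z =
        weyl d (fun p : {p // p ∈ T} => e p) x (fun p => z p) *
          (star (β w) * weyl d (fun p : {p // p ∉ T} => e p) w fun p => z p) := fun w => by
      rw [hW, hε1, hε2]
      simp only [braOn, partialBra, of_apply]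
      rw [hε1, hε2, if_pos rfl]
      ring
    rw [Finset.sum_congr rfl fun w _ => h3 w, ← Finset.mul_sum]
    rw [vecMul, dotProduct] at hc
    simp only [Pi.star_apply, Pi.smul_apply] at hc
    rw [hc, smul_eq_mul, smul_eq_mul]
    ring
  · intro x' _ hx'
    refine Finset.sum_eq_zero fun w _ => ?_
    simp only [braOn, partialBra, of_apply]
    rw [hε1, if_neg hx', zero_mul]
  · simp

/-- After a measurement of the other parties whose outcome is a joint eigenvector, the state of the
parties in `T` is supported in a joint eigenspace. -/
theorem exists_pauliOp_mul_braOn_conj {g : Fin k → P → PureExponent d} (T : Finset P)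
    {β : ({p // p ∉ T} → Fin d) → ℂ} (hβ : β ≠ 0)
    (hβg : ∀ a, ∃ c : ℂ, weyl d (fun p : {p // p ∉ T} => exponents (g a) p) *ᵥ β = c • β) :
    ∃ χ : Fin k → ℂ, ∀ a, pauliOp (restrict (g a) T) *
        (braOn T β * stabilizerState g * (braOn T β)ᴴ) =
      χ a • (braOn T β * stabilizerState g * (braOn T β)ᴴ) := by
  choose c hc using hβg
  -- The bra of an eigenvector with eigenvalue `c a` is a left eigenvector with eigenvalue `star (c
  -- a)⁻¹`; solving for the action on `T` inverts it.
  refine ⟨fun a => (star (c a)⁻¹)⁻¹, fun a => ?_⟩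
  have hc0 : c a ≠ 0 := weyl_eigenvalue_ne_zero hβ (hc a)
  have h1 : (weyl d fun p : {p // p ∉ T} => exponents (g a) p)ᴴ *ᵥ β = (c a)⁻¹ • β := by
    have h := congrArg (fun v => (weyl d fun p : {p // p ∉ T} => exponents (g a) p)ᴴ *ᵥ v) (hc a)
    simp only [mulVec_mulVec, weyl_conjTranspose_mul, one_mulVec, mulVec_smul] at h
    rw [h, smul_smul, inv_mul_cancel₀ hc0, one_smul, ← h]
  have h2 : star β ᵥ* weyl d (fun p : {p // p ∉ T} => exponents (g a) p) =
      star (c a)⁻¹ • star β := by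
    rw [← star_smul, ← h1, star_mulVec, conjTranspose_conjTranspose]
  have h3 := braOn_mul_weyl T h2
  have h4 : braOn T β * stabilizerState g = star (c a)⁻¹ •
      (pauliOp (restrict (g a) T) * (braOn T β * stabilizerState g)) := by
    conv_lhs => rw [← pauliOp_mul_stabilizerState g a, ← Matrix.mul_assoc, pauliOp_eq_weyl, h3,
      smul_mul, Matrix.mul_assoc]
    rfl
  have h5 : star (c a)⁻¹ ≠ 0 := star_ne_zero.2 (inv_ne_zero hc0)
  conv_rhs => rw [h4, smul_mul, smul_smul, inv_mul_cancel₀ h5, one_smul, Matrix.mul_assoc]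

theorem exists_braOn_conj_eq {g : Fin k → P → PureExponent d} (T : Finset P)
    {β : ({p // p ∉ T} → Fin d) → ℂ} (hβ : β ≠ 0)
    (hβg : ∀ a, ∃ c : ℂ, weyl d (fun p : {p // p ∉ T} => exponents (g a) p) *ᵥ β = c • β)
    {φ : ({p // p ∈ T} → Fin d) → ℂ} (hφ : star φ ⬝ᵥ φ = 1)
    (hfix : ∀ a, pauliOp (restrict (g a) T) *ᵥ φ = φ)
    (hline : ∀ v, (∀ a, pauliOp (restrict (g a) T) *ᵥ v = v) → ∃ c : ℂ, v = c • φ) :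
    ∃ e : {p // p ∈ T} → ℕ × ℕ, braOn T β * stabilizerState g * (braOn T β)ᴴ =
      (braOn T β * stabilizerState g * (braOn T β)ᴴ).trace •
        vecMulVec (weyl d e *ᵥ φ) (star (weyl d e *ᵥ φ)) := by
  obtain ⟨χ, hχ⟩ := exists_pauliOp_mul_braOn_conj (g := g) T hβ hβg
  have hH : (stabilizerState g)ᴴ = stabilizerState g := by
    rw [stabilizerState_eq, conjTranspose_smul, stabilizerProj_conjTranspose, star_inv₀,
      ← trace_conjTranspose, stabilizerProj_conjTranspose]
  refine exists_weyl_eq_trace_smul (g := fun a => restrict (g a) T) hφ hfix hline ?_ hχ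
  rw [conjTranspose_mul, conjTranspose_mul, conjTranspose_conjTranspose, hH, Matrix.mul_assoc]

/-- Products of eigenvectors of the blocks of a Weyl operator are eigenvectors. -/
theorem exists_weyl_mulVec_prod {κ : Type} {S : κ → Type} [Fintype κ] [DecidableEq κ]
    [∀ s, Fintype (S s)] [∀ s, DecidableEq (S s)] (ι : ∀ s, S s → P)
    (hι : Function.Bijective fun x : Σ s, S s => ι x.1 x.2) (e : P → ℕ × ℕ)
    (u : ∀ s, (S s → Fin d) → ℂ)
    (hu : ∀ s, ∃ c : ℂ, weyl d (fun t => e (ι s t)) *ᵥ u s = c • u s) :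
    ∃ c : ℂ, weyl d e *ᵥ (fun y => ∏ s, u s fun t => y (ι s t)) =
      c • fun y => ∏ s, u s fun t => y (ι s t) := by
  choose c hc using hu
  refine ⟨∏ s, c s, ?_⟩
  have h := tensor_mulVec_prod (K := fun _ => Fin d) ι hι (fun p => weylFactor d (e p)) u
  refine h.trans ?_
  ext x
  have h2 : ∀ s, (tensor (fun t => weylFactor d (e (ι s t))) *ᵥ u s) (fun t => x (ι s t)) =
      c s * u s fun t => x (ι s t) := fun s => congrFun (hc s) _
  simp only [h2, Finset.prod_mul_distrib, Pi.smul_apply, smul_eq_mul]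

theorem prod_ne_zero_of_regroup {κ : Type} {S : κ → Type} [Fintype κ] (ι : ∀ s, S s → P)
    (hι : Function.Bijective fun x : Σ s, S s => ι x.1 x.2)
    (u : ∀ s, (S s → Fin d) → ℂ) (hu : ∀ s, u s ≠ 0) :
    (fun y : P → Fin d => ∏ s, u s fun t => y (ι s t)) ≠ 0 := by
  choose y hy using fun s => Function.ne_iff.1 (hu s)
  intro h
  have h2 := congrFun h ((regroup ι hι fun _ => Fin d).symm y)
  refine Finset.prod_ne_zero_iff.2 (fun s _ => ?_) h2
  have h3 : (fun t => (regroup ι hι fun _ => Fin d).symm y (ι s t)) = y s :=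
    congrFun ((regroup ι hι fun _ => Fin d).apply_symm_apply y) s
  rw [h3]
  exact hy s

theorem sum_norm_sq_eq_one {I : Type*} [Fintype I] {ψ : I → ℂ} (h : star ψ ⬝ᵥ ψ = 1) :
    ∑ x, ‖ψ x‖ ^ 2 = 1 := by
  have h2 : (((∑ x, ‖ψ x‖ ^ 2 : ℝ)) : ℂ) = 1 := by
    rw [← h, dotProduct]
    push_cast
    exact Finset.sum_congr rfl fun x _ => (Complex.conj_mul' (ψ x)).symm
  exact_mod_cast h2

theorem orthonormalBasis_ofLp_ne_zero {I κ : Type*} [Fintype I] [Fintype κ]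
    (b : OrthonormalBasis κ ℂ (EuclideanSpace ℂ I)) (i : κ) : (b i).ofLp ≠ 0 := fun h => by
  have h1 := b.orthonormal.1 i
  rw [show b i = 0 from WithLp.ofLp_injective 2 h, norm_zero] at h1
  exact zero_ne_one h1

/-- A Weyl translate changes only the eigenvalues of a joint eigenvector. -/
theorem isGenuinelyEntangled_weyl {g : Fin k → P → PureExponent d} (hg : IsInseparable g)
    {φ : (P → Fin d) → ℂ} (hφ : star φ ⬝ᵥ φ = 1) (hfix : ∀ a, pauliOp (g a) *ᵥ φ = φ)
    (e : P → ℕ × ℕ) : IsGenuinelyEntangled (weyl d e *ᵥ φ) := by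
  have hφ0 : φ ≠ 0 := by rintro rfl; simp at hφ
  refine isGenuinelyEntangled_of_eigenvector hg (weyl_mulVec_ne_zero e hφ0) fun a =>
    ⟨∏ p, twist d (exponents (g a) p) (e p), ?_⟩
  rw [pauliOp_eq_weyl, weyl_mulVec_weyl_mulVec, ← pauliOp_eq_weyl, hfix]

/-- Each block other than `T` is measured in a joint eigenbasis of the generators restricted to it,
which exists by local commutation. -/
theorem leavesPureEntanglement {g : Fin k → P → PureExponent d}
    {Q : Finpartition (Finset.univ : Finset P)} {T : Finset P} (h : IsUnlockingBlock g Q T) :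
    LeavesPureEntanglement Q T (stabilizerState g) := by
  obtain ⟨-, hT, -, hQ, hins, hcomp⟩ := h
  obtain ⟨φ, hφ, hfix, hline⟩ := hcomp.exists_unit_vector
  choose b hb using fun U : OtherBlock Q T => exists_orthonormalBasis_pauliOp
    (fun a => restrict (g a) U.1) (hQ U.1 (Finset.mem_of_mem_erase U.2))
  refine ⟨b, fun o _ => ?_⟩
  have hU : ∀ (U : OtherBlock Q T) (p : {p // p ∈ U.1}), p.1 ∉ T := fun U p hpT => by
    obtain ⟨hne, hmem⟩ := Finset.mem_erase.1 U.2
    exact hne (Q.eq_of_mem_parts hmem hT p.2 hpT)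
  let ι : ∀ U : OtherBlock Q T, {p // p ∈ U.1} → {p // p ∉ T} := fun U p => ⟨p, hU U p⟩
  have hι : Function.Bijective fun x : Σ U : OtherBlock Q T, {p // p ∈ U.1} => ι x.1 x.2 := by
    constructor
    · rintro ⟨⟨U, hU⟩, ⟨p, hp⟩⟩ ⟨⟨V, hV⟩, ⟨p', hp'⟩⟩ h
      obtain rfl : p = p' := congrArg Subtype.val h
      obtain rfl : U = V := Q.eq_of_mem_parts (Finset.mem_of_mem_erase hU)
        (Finset.mem_of_mem_erase hV) hp hp'
      rfl
    · rintro ⟨p, hp⟩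
      obtain ⟨U, hU, hpU⟩ := Q.exists_mem (Finset.mem_univ p)
      exact ⟨⟨⟨U, Finset.mem_erase.2 ⟨fun h => hp (h ▸ hpU), hU⟩⟩, ⟨p, hpU⟩⟩, rfl⟩
  let β : ({p // p ∉ T} → Fin d) → ℂ := fun y => ∏ U, (b U (o U)).ofLp fun p => y (ι U p)
  have hbra : braOnOthers Q T (fun U => b U (o U)) = braOn T β := by
    ext x z
    simp only [braOnOthers, braOn, partialBra, of_apply, funext_iff, β, star_prod, ι]
  obtain ⟨e, he⟩ := exists_braOn_conj_eq (g := g) T (β := β)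
    (prod_ne_zero_of_regroup ι hι _ fun U => orthonormalBasis_ofLp_ne_zero (b U) (o U))
    (fun a => exists_weyl_mulVec_prod ι hι (fun p : {p // p ∉ T} => exponents (g a) p)
      (fun U => (b U (o U)).ofLp) fun U => hb U (o U) a) hφ hfix hline
  refine ⟨weyl d e *ᵥ φ, sum_norm_sq_eq_one ?_, isGenuinelyEntangled_weyl hins hφ hfix e, ?_⟩
  · rw [star_weyl_dotProduct_weyl, hφ]
  · rw [postMeasurement, hbra]
    exact he

end PartialBra

/-! ### Unlocking -/

section Unlocking

variable {d : ℕ} [NeZero d] {P : Type} [Fintype P] [DecidableEq P] {k : ℕ}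

/-- A two-round protocol: a measurement by every party, and local unitaries that depend on the
outcomes. -/
theorem IsLOCC.measure_correct {κ : Type} [Fintype κ] [DecidableEq κ] {A E B : κ → Type}
    [∀ U, Fintype (A U)] [∀ U, DecidableEq (A U)] [∀ U, Fintype (E U)] [∀ U, DecidableEq (E U)]
    [∀ U, Fintype (B U)] [∀ U, DecidableEq (B U)] (r : κ → ℕ)
    (K : ∀ U, Fin (r U) → Matrix (E U) (A U) ℂ) (hK : ∀ U, ∑ o, (K U o)ᴴ * K U o = 1)
    (L : (∀ U, Fin (r U)) → ∀ U, Matrix (B U) (E U) ℂ) (hL : ∀ o U, (L o U)ᴴ * L o U = 1) :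
    IsLOCC (B := B) A fun ρ => ∑ o, tensor (L o) *
      (tensor (fun U => K U (o U)) * ρ * (tensor fun U => K U (o U))ᴴ) * (tensor (L o))ᴴ := by
  refine IsLOCC.round A E r K hK (fun o σ => tensor (L o) * σ * (tensor (L o))ᴴ) fun o => ?_
  have h := IsLOCC.round E B (fun _ => 1) (fun U _ => L o U) (fun U => by simp [hL])
    (fun _ σ => σ) fun _ => IsLOCC.done
  simpa using h

/-- With no party besides `i` and `j`, nothing is traced out. -/
theorem pairFidelity_pure {κ : Type} [Fintype κ] [DecidableEq κ] {H : κ → Type}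
    [∀ U, Fintype (H U)] [∀ U, DecidableEq (H U)] {i j : κ}
    (huniv : ∀ U, U = i ∨ U = j) {φ : (∀ U, H U) → ℂ} (hφ : star φ ⬝ᵥ φ = 1)
    {φ' : H i → H j → ℂ} (hφ' : ∀ x, φ' (x i) (x j) = φ x) :
    pairFidelity i j φ' (vecMulVec φ (star φ)) = 1 := by
  have h : ∑ x : ∀ U, H U, ∑ y : ∀ U, H U, (if ∀ U, U ≠ i → U ≠ j → x U = y U then
      star (φ' (x i) (x j)) * vecMulVec φ (star φ) x y * φ' (y i) (y j) else 0) =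
      (star φ ⬝ᵥ φ) * (star φ ⬝ᵥ φ) := by
    rw [dotProduct, Fintype.sum_mul_sum]
    refine Finset.sum_congr rfl fun x _ => Finset.sum_congr rfl fun y _ => ?_
    rw [if_pos fun U h h' => ((huniv U).elim h h').elim, hφ', hφ', vecMulVec_apply]
    simp only [Pi.star_apply]
    ring
  rw [pairFidelity, h, hφ, one_mul, Complex.one_re]

theorem weyl_regroup {κ : Type} {S : κ → Type} [Fintype κ] [∀ s, Fintype (S s)]
    (ι : ∀ s, S s → P) (hι : Function.Bijective fun x : Σ s, S s => ι x.1 x.2) (e : P → ℕ × ℕ)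
    (x y : P → Fin d) :
    weyl d e x y = tensor (fun s => weyl d fun t => e (ι s t)) (fun s t => x (ι s t))
      fun s t => y (ι s t) := by
  simp only [weyl, tensor_apply]
  exact prod_regroup ι hι _

theorem bijective_inter_parts (R : Finpartition (Finset.univ : Finset P)) (q : P → Prop) :
    Function.Bijective fun x : Σ U : R.parts, {p // p ∈ U.1 ∧ q p} =>
      (⟨x.2.1, x.2.2.2⟩ : {p // q p}) := by
  constructor
  · rintro ⟨⟨U, hU⟩, ⟨p, hp, hq⟩⟩ ⟨⟨V, hV⟩, ⟨p', hp', hq'⟩⟩ h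
    obtain rfl : p = p' := congrArg Subtype.val h
    obtain rfl : U = V := R.eq_of_mem_parts hU hV hp hp'
    rfl
  · rintro ⟨p, hp⟩
    obtain ⟨U, hU, hpU⟩ := R.exists_mem (Finset.mem_univ p)
    exact ⟨⟨⟨U, hU⟩, ⟨p, hpU, hp⟩⟩, rfl⟩

theorem bijective_parts (R : Finpartition (Finset.univ : Finset P)) :
    Function.Bijective fun x : Σ U : R.parts, {p // p ∈ U.1} => x.2.1 := by
  constructor
  · rintro ⟨⟨U, hU⟩, ⟨p, hp⟩⟩ ⟨⟨V, hV⟩, ⟨p', hp'⟩⟩ h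
    obtain rfl : p = p' := h
    obtain rfl : U = V := R.eq_of_mem_parts hU hV hp hp'
    rfl
  · intro p
    obtain ⟨U, hU, hpU⟩ := R.exists_mem (Finset.mem_univ p)
    exact ⟨⟨⟨U, hU⟩, ⟨p, hpU⟩⟩, rfl⟩

/-- A configuration of the parties as a single copy held by the groups. -/
def groupConfig (d : ℕ) (R : Finpartition (Finset.univ : Finset P)) :
    (P → Fin d) ≃ ∀ U : R.parts, Fin 1 → ∀ _ : U.1, Fin d :=
  (regroup (fun (U : R.parts) (p : U.1) => p.1) (bijective_parts R) fun _ => Fin d).trans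
    (Equiv.piCongrRight fun _ => (Equiv.funUnique (Fin 1) _).symm)

theorem copies_one_group (R : Finpartition (Finset.univ : Finset P))
    (ρ : Matrix (P → Fin d) (P → Fin d) ℂ) :
    copies 1 (group R ρ) = ρ.submatrix (groupConfig d R).symm (groupConfig d R).symm := by
  ext x y
  obtain ⟨x, rfl⟩ := (groupConfig d R).surjective x
  obtain ⟨y, rfl⟩ := (groupConfig d R).surjective y
  simp only [submatrix_apply, Equiv.symm_apply_apply, copies, of_apply, Finset.univ_unique,
    Finset.prod_singleton]
  rfl

/-- If the parties outside `T` can measure their systems in a joint eigenbasis, blockwise with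
respect to a partition into two blocks that divides `T`, then entanglement between the two blocks
can be distilled. -/
theorem isDistillable_group {g : Fin k → P → PureExponent d} (hV : stabilized g ≠ ⊥)
    (T : Finset P) (hins : IsInseparable fun a => restrict (g a) T)
    (hcomp : IsComplete fun a => restrict (g a) T)
    (R : Finpartition (Finset.univ : Finset P)) {U V : R.parts} (hUV : U ≠ V)
    (huniv : ∀ W, W = U ∨ W = V) (hU : ∃ p ∈ U.1, p ∈ T) (hV' : ∃ p ∈ V.1, p ∈ T)
    (hR : ∀ (W : R.parts) (a b : Fin k), ∏ p : {p // p ∈ W.1 ∧ p ∉ T},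
      twist d (exponents (g a) p) (exponents (g b) p) = 1) :
    IsDistillable (group R (stabilizerState g)) U V := by
  obtain ⟨φ, hφ, hfix, hline⟩ := hcomp.exists_unit_vector
  have hφ0 : φ ≠ 0 := by rintro rfl; simp at hφ
  have hgen : IsGenuinelyEntangled φ := isGenuinelyEntangled_of_eigenvector hins hφ0
    fun a => ⟨1, by rw [hfix, one_smul]⟩
  choose c hc using fun W : R.parts => exists_orthonormalBasis_pauliOp
    (fun a (p : {p // p ∈ W.1 ∧ p ∉ T}) => g a p)
    fun a b => (commute_pauliOp_iff _ _).2 (hR W a b)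
  -- Outcomes, and below the output systems, are relabelled by `Fin` to fit `IsLOCC` and
  -- `IsDistillable`.
  let r : R.parts → ℕ := fun W => Fintype.card ({p // p ∈ W.1 ∧ p ∉ T} → Fin d)
  let f : ∀ W : R.parts, (Fin 1 → ∀ _ : W.1, Fin d) → {p // p ∈ W.1 ∧ p ∈ T} → Fin d :=
    fun W z p => z 0 ⟨p.1, p.2.1⟩
  let h : ∀ W : R.parts, (Fin 1 → ∀ _ : W.1, Fin d) → {p // p ∈ W.1 ∧ p ∉ T} → Fin d :=
    fun W z p => z 0 ⟨p.1, p.2.1⟩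
  let c' : ∀ W : R.parts, OrthonormalBasis (Fin (r W)) ℂ
      (EuclideanSpace ℂ ({p // p ∈ W.1 ∧ p ∉ T} → Fin d)) :=
    fun W => (c W).reindex (Fintype.equivFin _)
  let ιS : ∀ W : R.parts, {p // p ∈ W.1 ∧ p ∉ T} → {p // p ∉ T} := fun W p => ⟨p.1, p.2.2⟩
  let ιT : ∀ W : R.parts, {p // p ∈ W.1 ∧ p ∈ T} → {p // p ∈ T} := fun W p => ⟨p.1, p.2.2⟩
  have hιS := bijective_inter_parts R (· ∉ T)
  have hιT := bijective_inter_parts R (· ∈ T)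
  let β : (∀ W, Fin (r W)) → ({p // p ∉ T} → Fin d) → ℂ :=
    fun o y => ∏ W, (c' W (o W)).ofLp fun p => y (ιS W p)
  have hβ : ∀ o, β o ≠ 0 := fun o =>
    prod_ne_zero_of_regroup ιS hιS _ fun W => orthonormalBasis_ofLp_ne_zero (c' W) (o W)
  have hβg : ∀ o a, ∃ c : ℂ,
      weyl d (fun p : {p // p ∉ T} => exponents (g a) p) *ᵥ β o = c • β o := fun o a =>
    exists_weyl_mulVec_prod ιS hιS (fun p : {p // p ∉ T} => exponents (g a) p)
      (fun W => (c' W (o W)).ofLp) fun W => by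
        simp only [c', OrthonormalBasis.reindex_apply]
        exact hc W _ a
  choose e he using fun o => exists_braOn_conj_eq (g := g) T (hβ o) (hβg o) hφ hfix hline
  let B : R.parts → ℕ := fun W => Fintype.card ({p // p ∈ W.1 ∧ p ∈ T} → Fin d)
  let εT : ({p // p ∈ T} → Fin d) ≃ ∀ W : R.parts, {p // p ∈ W.1 ∧ p ∈ T} → Fin d :=
    regroup ιT hιT fun _ => Fin d
  let η : ({p // p ∈ T} → Fin d) ≃ ∀ W : R.parts, Fin (B W) :=
    εT.trans (Equiv.piCongrRight fun W => Fintype.equivFin _)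
  let K : ∀ W, Fin (r W) → Matrix ({p // p ∈ W.1 ∧ p ∈ T} → Fin d)
      (Fin 1 → ∀ _ : W.1, Fin d) ℂ := fun W o => partialBra (f W) (h W) (c' W o).ofLp
  -- The correction inverts the Weyl translation left by outcome `o`; being a tensor product, it can
  -- be applied by each group separately.
  let L : (∀ W, Fin (r W)) → ∀ W, Matrix (Fin (B W)) ({p // p ∈ W.1 ∧ p ∈ T} → Fin d) ℂ :=
    fun o W => (weyl d fun p => e o (ιT W p))ᴴ.submatrix (Fintype.equivFin _).symm id
  have hK : ∀ W, ∑ o, (K W o)ᴴ * K W o = 1 := fun W => by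
    refine sum_partialBra _ _ (fun z z' h1 h2 => ?_) (c' W)
    funext i p
    obtain rfl : i = 0 := Subsingleton.elim _ _
    by_cases hp : p.1 ∈ T
    · exact congrFun h1 ⟨p.1, p.2, hp⟩
    · exact congrFun h2 ⟨p.1, p.2, hp⟩
  have hL : ∀ o W, (L o W)ᴴ * L o W = 1 := fun o W => by
    simp only [L, conjTranspose_submatrix, conjTranspose_conjTranspose]
    rw [submatrix_mul_equiv, weyl_mul_conjTranspose, submatrix_id_id]
  have hKo : ∀ o, tensor (fun W => K W (o W)) =
      (braOn T (β o)).submatrix εT.symm (groupConfig d R).symm := fun o => by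
    rw [show tensor (fun W => K W (o W)) = _ from tensor_partialBra _ _ _]
    ext x z
    obtain ⟨x, rfl⟩ := εT.surjective x
    obtain ⟨z, rfl⟩ := (groupConfig d R).surjective z
    simp only [submatrix_apply, Equiv.symm_apply_apply, braOn, partialBra, of_apply]
    have hiff : ((fun W => f W (groupConfig d R z W)) = εT x) ↔
        (fun p : {p // p ∈ T} => z p) = x := by
      rw [← εT.injective.eq_iff]
      rfl
    simp only [hiff]
    rfl
  have hLo : ∀ o, tensor (L o) = (weyl d (e o))ᴴ.submatrix η.symm εT.symm := fun o => by
    ext x y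
    obtain ⟨x, rfl⟩ := η.surjective x
    obtain ⟨y, rfl⟩ := εT.surjective y
    simp only [submatrix_apply, Equiv.symm_apply_apply, conjTranspose_apply]
    rw [weyl_regroup ιT hιT]
    simp only [tensor_apply, star_prod]
    refine Finset.prod_congr rfl fun W _ => ?_
    simp only [L, submatrix_apply, conjTranspose_apply, id, η, Equiv.trans_apply,
      Equiv.piCongrRight_apply, Pi.map_apply, Equiv.symm_apply_apply]
    rfl
  let φ' : (∀ W, Fin (B W)) → ℂ := φ ∘ η.symm
  have hφ' : star φ' ⬝ᵥ φ' = 1 := by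
    rw [← hφ]
    exact η.symm.sum_comp fun x => star (φ x) * φ x
  have hbranch : ∀ o, ∃ t : ℂ, tensor (L o) * (tensor (fun W => K W (o W)) *
      copies 1 (group R (stabilizerState g)) * (tensor fun W => K W (o W))ᴴ) * (tensor (L o))ᴴ =
      t • vecMulVec φ' (star φ') := fun o => by
    refine ⟨(braOn T (β o) * stabilizerState g * (braOn T (β o))ᴴ).trace, ?_⟩
    rw [hKo, hLo, copies_one_group, conjTranspose_submatrix, conjTranspose_submatrix,
      submatrix_mul_equiv, submatrix_mul_equiv, submatrix_mul_equiv, submatrix_mul_equiv]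
    nth_rw 1 [he o]
    rw [Matrix.mul_smul, smul_mul, mul_vecMulVec_mul_conjTranspose, mulVec_mulVec,
      weyl_conjTranspose_mul, one_mulVec]
    rfl
  choose t ht using hbranch
  have hE : IsEmpty {W // W ≠ U ∧ W ≠ V} := ⟨fun W => (huniv W.1).elim W.2.1 W.2.2⟩
  obtain ⟨φp, hφp⟩ : ∃ φp : Fin (B U) → Fin (B V) → ℂ, ∀ x, φp (x U) (x V) = φ' x := by
    refine ⟨fun a b => φ' ((splitPair (fun W => Fin (B W)) hUV).symm (hE.elim, (a, b))),
      fun x => ?_⟩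
    refine congrArg φ' ((Equiv.symm_apply_eq _).2 ?_)
    exact Prod.ext (Subsingleton.elim _ _) rfl
  have hLOCC := IsLOCC.measure_correct r K hK L hL
  -- One copy serves every `ε`, since the protocol is exact.
  refine ⟨B, φp, ?_, ?_, fun ε hε => ⟨1, _, hLOCC, ?_⟩⟩
  · rw [← sum_norm_sq_eq_one hφ', ← Fintype.sum_prod_type']
    simp only [← hφp]
    have h1 := (splitPair (fun W => Fin (B W)) hUV).sum_comp
      fun s => ‖φp s.2.1 s.2.2‖ ^ 2
    rw [Fintype.sum_prod_type] at h1
    exact (Fintype.sum_unique _).symm.trans h1.symm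
  · rintro ⟨u, v, huv⟩
    obtain ⟨p, hpU, hpT⟩ := hU
    obtain ⟨p', hpV, hpT'⟩ := hV'
    have hdisj : ∀ p, p ∈ V.1 → p ∉ U.1 := fun p hpV hpU =>
      hUV (Subtype.ext (R.eq_of_mem_parts U.2 V.2 hpU hpV))
    -- A product form of the two-party state would factor `φ` across the part of `T` inside `U`.
    refine hgen (Finset.univ.filter fun p => p.1 ∈ U.1) ⟨⟨p, hpT⟩, by simpa using hpU⟩ ?_
      ⟨fun y => u (Fintype.equivFin _ fun s : {p // p ∈ U.1 ∧ p ∈ T} =>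
          y ⟨⟨s, s.2.2⟩, by simpa using s.2.1⟩),
        fun y => v (Fintype.equivFin _ fun s : {p // p ∈ V.1 ∧ p ∈ T} =>
          y ⟨⟨s, s.2.2⟩, by simpa using hdisj s s.2.1⟩), fun x => ?_⟩
    · intro h
      have := Finset.eq_univ_iff_forall.1 h ⟨p', hpT'⟩
      exact hdisj p' hpV (by simpa using this)
    · have h1 : φ' (η x) = φ x := congrArg φ (η.symm_apply_apply x)
      rw [← h1, ← hφp, huv]
      rfl
  -- Every branch ends in a multiple of the same pure state, and trace preservation makes the
  -- multiples sum to 1.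
  · have htr := hLOCC.trace_eq (copies 1 (group R (stabilizerState g)))
    have hsum : ∑ o, tensor (L o) * (tensor (fun W => K W (o W)) *
        copies 1 (group R (stabilizerState g)) * (tensor fun W => K W (o W))ᴴ) *
          (tensor (L o))ᴴ = (∑ o, t o) • vecMulVec φ' (star φ') := by
      rw [Finset.sum_smul]
      exact Finset.sum_congr rfl fun o _ => ht o
    have htr2 : (copies 1 (group R (stabilizerState g))).trace = 1 := by
      rw [copies_one_group, ← (isDensity_stabilizerState hV).2]
      exact (groupConfig d R).symm.sum_comp fun x => stabilizerState g x x
    simp only [hsum] at htr ⊢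
    rw [htr2, trace_smul, trace_vecMulVec, dotProduct_comm, hφ', smul_eq_mul, mul_one] at htr
    rw [htr, one_smul, pairFidelity_pure (H := fun W => Fin (B W)) huniv hφ' hφp]
    linarith

/-- One party `p` of `T` against all the others joined is a grouping that suffices. -/
theorem isUnlockable_stabilizerState {g : Fin k → P → PureExponent d} (hV : stabilized g ≠ ⊥)
    (hcomm : ∀ a b, Commute (pauliOp (g a)) (pauliOp (g b)))
    {Q : Finpartition (Finset.univ : Finset P)} {T : Finset P} (h : IsUnlockingBlock g Q T) :
    IsUnlockable (stabilizerState g) := by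
  obtain ⟨-, hT, hcard, hQ, hins, hcomp⟩ := h
  obtain ⟨p, hp, p', hp', hne⟩ := Finset.one_lt_card.1 hcard
  have hA : ({p} : Finset P) ≠ Finset.univ := fun h => hne (by
    have := Finset.mem_univ p'
    rw [← h, Finset.mem_singleton] at this
    exact this.symm)
  let R := bipartition {p} (Finset.singleton_nonempty p) hA
  have hmem : ∀ W : R.parts, W.1 = {p}ᶜ ∨ W.1 = {p} := fun W => mem_bipartition_parts.1 W.2
  refine ⟨R, ⟨{p}, mem_bipartition_parts.2 (Or.inr rfl)⟩,
    ⟨{p}ᶜ, mem_bipartition_parts.2 (Or.inl rfl)⟩, ?_, ?_⟩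
  · intro h
    have h2 := congrArg (fun W : R.parts => p ∈ W.1) h
    simp at h2
  · refine isDistillable_group hV T hins hcomp R ?_ ?_ ⟨p, by simp, hp⟩
      ⟨p', by simpa using hne.symm, hp'⟩ ?_
    · intro h
      have h2 := congrArg (fun W : R.parts => p ∈ W.1) h
      simp at h2
    · intro W
      rcases hmem W with h | h
      · exact Or.inr (Subtype.ext h)
      · exact Or.inl (Subtype.ext h)
    -- The group `{p}` has no qudits outside `T`. The other group has all of them, and there the
    -- phases multiply to 1 because they do so globally and on `T`.
    · intro W a b
      rcases hmem W with h | h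
      · have h1 := (commute_pauliOp_iff _ _).1 (hcomm a b)
        rw [← Finset.prod_mul_prod_compl T, (commuteLocally_iff g Q).1 hQ T hT a b, one_mul,
          Finset.prod_subtype (p := fun i => i ∈ W.1 ∧ i ∉ T)] at h1
        · exact h1
        · intro i
          rw [h, Finset.mem_compl, Finset.mem_compl, Finset.mem_singleton]
          exact ⟨fun hi => ⟨fun hip => hi (hip ▸ hp), hi⟩, fun hi => hi.2⟩
      · refine Finset.prod_eq_one fun i _ => ?_
        have h2 : i.1 = p := Finset.mem_singleton.1 (h.subset i.2.1)
        exact absurd (h2 ▸ hp) i.2.2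

end Unlocking

end StabilizerBoundEntanglement

end

/-! ### The main theorem -/

open StabilizerBoundEntanglement in
theorem theorem1 {d n k : ℕ} [NeZero d] (g : Fin k → Fin n → PureExponent d)
    (hcomm : ∀ a b, Commute (pauliOp (g a)) (pauliOp (g b)))
    (hV : stabilized g ≠ ⊥)
    (h1 : ∀ i j : Fin n, i ≠ j →
      ∃ Q : Finpartition (Finset.univ : Finset (Fin n)), Finset.univ ∉ Q.parts ∧
        (∃ Q₁ ∈ Q.parts, ∃ Q₂ ∈ Q.parts, Q₁ ≠ Q₂ ∧ i ∈ Q₁ ∧ j ∈ Q₂) ∧ CommuteLocally g Q)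
    (h2 : ∃ (Q : Finpartition (Finset.univ : Finset (Fin n))) (T : Finset (Fin n)),
      IsUnlockingBlock g Q T) :
    IsBoundEntangled (stabilizerState g) ∧ IsUnlockable (stabilizerState g) ∧
      ∀ (Q : Finpartition (Finset.univ : Finset (Fin n))) (T : Finset (Fin n)),
        IsUnlockingBlock g Q T → LeavesPureEntanglement Q T (stabilizerState g) := by
  obtain ⟨Q, T, hQT⟩ := h2
  refine ⟨⟨isDensity_stabilizerState hV, fun hsep => ?_, fun i j hij => ?_⟩,
    isUnlockable_stabilizerState hV hcomm hQT, fun Q T h => leavesPureEntanglement h⟩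
  · obtain ⟨-, -, hcard, -, hins, -⟩ := hQT
    obtain ⟨a, b, p, hp⟩ := hins.exists_twist_ne_one (by simpa using hcard)
    exact hp (hsep.twist_eq_one a b p.1)
  · obtain ⟨Q, -, ⟨Q₁, hQ₁, Q₂, hQ₂, hne, hi, hj⟩, hQ⟩ := h1 i j hij
    exact not_isDistillable_stabilizerState Q₁ hV hcomm (hQ Q₁ hQ₁) hi
      fun hj' => hne (Q.eq_of_mem_parts hQ₁ hQ₂ hj' hj)
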